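/- For a nonempty set $A\subset\mathbb{Z}^d$ ($d\ge 0$) let $\Omega = A+[0,1)^d\subset\mathbb{R}^d$ be the corresponding union of unit cubes. Call $\Omega$ spectral in $\mathbb{R}^d$ if there is a set $\Lambda$ of continuous characters of $\mathbb{R}^d$ (continuous homomorphisms from $\mathbb{R}^d$ to the unit circle) whose restrictions to $\Omega$ form an orthogonal basis of $L^2(\Omega)$ with respect to Lebesgue measure, i.e. they are nonzero and pairwise orthogonal in $L^2(\Omega)$ and their linear span is dense. Say that $\Omega$ tiles $\mathbb{R}^d$ (by translation) if there is a set $T\subset\mathbb{R}^d$ with $\sum_{t\in T}\chi_\Omega(x-t)=1$ for Lebesgue-almost all $x\in\mathbb{R}^d$, where $\chi_\Omega$ is the indicator function of $\Omega$. **Theorem.** Let $A\subset\mathbb{Z}^d$ be a nonempty set with $|A|\le 5$ and let $\Omega=A+[0,1)^d$. If $\Omega$ is spectral in $\mathbb{R}^d$, then $\Omega$ tiles $\mathbb{R}^d$. -/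

import Mathlib

open scoped Pointwise ENNReal
open MeasureTheory

/-- `Λ` is a spectrum of `Ω` in the abelian topological group `G` with Haar measure `μ`: it is a set
of continuous characters of `G` whose restrictions to `Ω` form an orthogonal basis of the Hilbert
space `L²(Ω)`, that is, they are nonzero, pairwise orthogonal elements of `L²(Ω)` whose linear
span is dense. -/
def IsSpectrum {G : Type*} [AddCommGroup G] [TopologicalSpace G] [MeasurableSpace G]
    (μ : Measure G) (Ω : Set G) (Λ : Set (AddChar G Circle)) : Prop :=
  (∀ χ ∈ Λ, Continuous χ) ∧
  ∃ v : Λ → Lp ℂ 2 (μ.restrict Ω),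
    (∀ χ : Λ, v χ =ᵐ[μ.restrict Ω] fun x => ((χ : AddChar G Circle) x : ℂ)) ∧
    (∀ χ : Λ, v χ ≠ 0) ∧
    (∀ χ ψ : Λ, χ ≠ ψ → inner ℂ (v χ) (v ψ) = 0) ∧
    (Submodule.span ℂ (Set.range v)).topologicalClosure = ⊤

/-- `Ω` is spectral if it has a spectrum. -/
def IsSpectral {G : Type*} [AddCommGroup G] [TopologicalSpace G] [MeasurableSpace G]
    (μ : Measure G) (Ω : Set G) : Prop :=
  ∃ Λ : Set (AddChar G Circle), IsSpectrum μ Ω Λ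

/-- `T` is a tiling complement of `Ω`: `∑_{t ∈ T} 1_Ω(x - t) = 1` for almost all `x`. The sum is
taken in `[0, ∞]`, so it always has its true value. -/
def IsTilingComplement {G : Type*} [AddCommGroup G] [MeasurableSpace G]
    (μ : Measure G) (Ω T : Set G) : Prop :=
  ∀ᵐ x ∂μ, ∑' t : T, Ω.indicator (fun _ => (1 : ℝ≥0∞)) (x - (t : G)) = 1

/-- `Ω` tiles `G` by translation if it has a tiling complement. -/
def Tiles {G : Type*} [AddCommGroup G] [MeasurableSpace G] (μ : Measure G) (Ω : Set G) : Prop :=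
  ∃ T : Set G, IsTilingComplement μ Ω T

/-- The union of unit cubes `A + [0,1)^d` in `ℝ^d`, for `A ⊂ ℤ^d`. -/
def unitCubes {d : ℕ} (A : Finset (Fin d → ℤ)) : Set (Fin d → ℝ) :=
  (fun (a : Fin d → ℤ) (i : Fin d) => (a i : ℝ)) '' (A : Set (Fin d → ℤ)) +
    Set.univ.pi fun _ : Fin d => Set.Ico (0 : ℝ) 1

/-! Let `n` be the number of cubes. The indicator of `Ω` is the convolution of `A` with the unit
cube, so its Fourier transform is `charSum A` times that of the cube. By Parseval, the translates of
the power spectrum of `Ω` along a spectrum sum to `n²`, while its integral is at most `n`. A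
spectrum thus has density at least `n`, and some half-open unit cube contains `n` frequencies
(`exists_fin_embedding_mem_unitCube`). Two of them differ by less than 1 in each coordinate, where
the transform of the cube has no zero, so orthogonality on `Ω` becomes orthogonality on `A`. The
values of these `n` characters on `A` form a complex Hadamard matrix of order `n ≤ 5`.

It remains to tile `ℤ^d` by `A` (`exists_tiling_of_hadamard`). If a character maps `A` bijectively
onto a coset of the `n`-th roots of unity, the points where it takes a chosen representative of its
coset form a tiling complement. For `n = 2, 3` the quotient of any two rows is such a character,
because its values have zero sum. For `n = 4` values with zero sum cancel in pairs, and two rows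
that share a pairing give a tiling by two signs.

For `n = 5` the sum of squares of the values must vanish as well; `exists_sum_sq_eq_zero` finds two
rows for which it does. After dividing by one row, a square root `ξ` of a second row turns the other
three rows into vectors whose real and imaginary parts are orthogonal to those of `ξ`. The matrices
`deviationMatrix` built from them lie on one line and sum to zero. Comparing the traces of their
squares and cubes gives a cubic equation for their coordinates on that line, which forces one of the
three vectors to be extremal. -/

open ComplexConjugate

/-! ### Real matrices behind Hadamard matrices of order five -/

open Matrix in
/-- For vectors `α`, `β`, `γ`, `δ` in `ℝ⁵`, the symmetric matrix
`ααᵀ + ββᵀ + (2/3)(γγᵀ + δδᵀ) - 5/3`. -/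
noncomputable def deviationMatrix (α β γ δ : Fin 5 → ℝ) : Matrix (Fin 5) (Fin 5) ℝ :=
  vecMulVec α α + vecMulVec β β + (2 / 3 : ℝ) • (vecMulVec γ γ + vecMulVec δ δ) -
    (5 / 3 : ℝ) • (1 : Matrix (Fin 5) (Fin 5) ℝ)

theorem deviationMatrix_apply (α β γ δ : Fin 5 → ℝ) (i j : Fin 5) :
    deviationMatrix α β γ δ i j = α i * α j + β i * β j + 2 / 3 * (γ i * γ j + δ i * δ j) -
      5 / 3 * if i = j then 1 else 0 := by
  simp only [deviationMatrix, Matrix.sub_apply, Matrix.add_apply, Matrix.smul_apply,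
    Matrix.vecMulVec_apply, Matrix.one_apply, smul_eq_mul]

section Trace

open Matrix

variable {α β γ δ : Fin 5 → ℝ} (hαγ : α ⬝ᵥ γ = 0) (hαδ : α ⬝ᵥ δ = 0) (hβγ : β ⬝ᵥ γ = 0)
  (hβδ : β ⬝ᵥ δ = 0) (hγγ : γ ⬝ᵥ γ = 5 / 2) (hδδ : δ ⬝ᵥ δ = 5 / 2) (hγδ : γ ⬝ᵥ δ = 0)
  (hαβ : α ⬝ᵥ α + β ⬝ᵥ β = 5)

include hαγ hαδ hβγ hβδ hγγ hδδ hγδ in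
theorem deviationMatrix_mul_self : deviationMatrix α β γ δ * deviationMatrix α β γ δ =
    (α ⬝ᵥ α) • vecMulVec α α + (α ⬝ᵥ β) • (vecMulVec α β + vecMulVec β α) +
      (β ⬝ᵥ β) • vecMulVec β β - (10 / 3 : ℝ) • (vecMulVec α α + vecMulVec β β)
      - (10 / 9 : ℝ) • (vecMulVec γ γ + vecMulVec δ δ) + (25 / 9 : ℝ) • 1 := by
  have h1 := dotProduct_comm γ α
  have h2 := dotProduct_comm δ α
  have h3 := dotProduct_comm γ β
  have h4 := dotProduct_comm δ β
  have h5 := dotProduct_comm δ γ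
  have h6 := dotProduct_comm β α
  rw [hαγ] at h1; rw [hαδ] at h2; rw [hβγ] at h3; rw [hβδ] at h4; rw [hγδ] at h5
  simp only [deviationMatrix, add_mul, mul_add, sub_mul, mul_sub, smul_mul_assoc, mul_smul_comm,
    vecMulVec_mul_vecMulVec, hαγ, hαδ, hβγ, hβδ, hγγ, hδδ, hγδ, h1, h2, h3, h4, h5, h6, one_mul,
    mul_one, zero_smul, vecMulVec_smul, vecMulVec_zero, smul_zero, add_zero, zero_add]
  module

-- The matrix vanishes on `γ`, `δ`; its other eigenvalues are `-5/3`, `λ - 5/3` and `μ - 5/3`, where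
-- `λ`, `μ` are the eigenvalues of the Gram matrix of `α`, `β` and `λ + μ = 5`. The last summand is
-- `(λ - μ)² / 2`, and `(λ - μ)²` is the squared modulus of the sum of the `(α i + i β i)²`.
include hαγ hαδ hβγ hβδ hγγ hδδ hγδ hαβ in
theorem trace_deviationMatrix_sq :
    (deviationMatrix α β γ δ * deviationMatrix α β γ δ).trace =
      25 / 6 + ((α ⬝ᵥ α - β ⬝ᵥ β) ^ 2 + 4 * (α ⬝ᵥ β) ^ 2) / 2 := by
  rw [deviationMatrix_mul_self hαγ hαδ hβγ hβδ hγγ hδδ hγδ]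
  have h6 := dotProduct_comm β α
  have hβ : β ⬝ᵥ β = 5 - α ⬝ᵥ α := by linarith
  simp only [trace_add, trace_sub, trace_smul, trace_vecMulVec, trace_one, hγγ, hδδ, h6, hβ,
    smul_eq_mul, Fintype.card_fin]
  push_cast
  ring

-- Besides 0, 0 the eigenvalues are `-5/3`, `p`, `q` with `p + q = 5/3`. As the trace is zero, the
-- cubes sum to `3 · (-5/3) p q`, and the sum of squares determines `p q`.
include hαγ hαδ hβγ hβδ hγγ hδδ hγδ hαβ in
theorem trace_deviationMatrix_cube :
    (deviationMatrix α β γ δ * deviationMatrix α β γ δ * deviationMatrix α β γ δ).trace =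
      5 / 2 * (deviationMatrix α β γ δ * deviationMatrix α β γ δ).trace - 125 / 9 := by
  rw [trace_deviationMatrix_sq hαγ hαδ hβγ hβδ hγγ hδδ hγδ hαβ,
    deviationMatrix_mul_self hαγ hαδ hβγ hβδ hγγ hδδ hγδ, deviationMatrix]
  have h1 := dotProduct_comm γ α
  have h2 := dotProduct_comm δ α
  have h3 := dotProduct_comm γ β
  have h4 := dotProduct_comm δ β
  have h5 := dotProduct_comm δ γ
  have h6 := dotProduct_comm β α
  rw [hαγ] at h1; rw [hαδ] at h2; rw [hβγ] at h3; rw [hβδ] at h4; rw [hγδ] at h5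
  have hβ : β ⬝ᵥ β = 5 - α ⬝ᵥ α := by linarith
  simp only [add_mul, mul_add, sub_mul, mul_sub, smul_mul_assoc, mul_smul_comm,
    vecMulVec_mul_vecMulVec, hαγ, hαδ, hβγ, hβδ, hγγ, hδδ, hγδ, h1, h2, h3, h4, h5, h6, one_mul,
    mul_one, zero_smul, vecMulVec_smul, vecMulVec_zero, smul_zero, add_zero, zero_add, trace_add, trace_sub,
    trace_smul, trace_vecMulVec, trace_one, trace_zero, hβ, smul_eq_mul, Fintype.card_fin]
  push_cast
  ring

end Trace

/-- A symmetric `5 × 5` matrix with zero diagonal that annihilates two vectors is determined by one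
off-diagonal entry, if enough `2 × 2` minors of the two vectors are nonzero. -/
theorem eq_zero_of_apply_zero_one_eq_zero (N : Matrix (Fin 5) (Fin 5) ℝ) (γ δ : Fin 5 → ℝ)
    (hsymm : ∀ i j, N i j = N j i) (hdiag : ∀ i, N i i = 0)
    (hγ : ∀ i, ∑ j, N i j * γ j = 0) (hδ : ∀ i, ∑ j, N i j * δ j = 0)
    (h01 : γ 0 * δ 1 - γ 1 * δ 0 ≠ 0) (h23 : γ 2 * δ 3 - γ 3 * δ 2 ≠ 0)
    (h24 : γ 2 * δ 4 - γ 4 * δ 2 ≠ 0) (h34 : γ 3 * δ 4 - γ 4 * δ 3 ≠ 0)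
    (h : N 0 1 = 0) : N = 0 := by
  set e : Fin 5 → Fin 5 → ℝ := fun i j => γ i * δ j - γ j * δ i with he
  simp only [Fin.sum_univ_five] at hγ hδ
  have s10 := hsymm 1 0
  have s20 := hsymm 2 0
  have s30 := hsymm 3 0
  have s40 := hsymm 4 0
  have s21 := hsymm 2 1
  have s31 := hsymm 3 1
  have s41 := hsymm 4 1
  have s32 := hsymm 3 2
  have s42 := hsymm 4 2
  have s43 := hsymm 4 3
  have g0 := hγ 0
  have g1 := hγ 1
  have g2 := hγ 2
  have g3 := hγ 3
  have g4 := hγ 4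
  have d0 := hδ 0
  have d1 := hδ 1
  have d2 := hδ 2
  have d3 := hδ 3
  have d4 := hδ 4
  simp only [hdiag, s10, s20, s30, s40, s21, s31, s41, s32, s42, s43, h, zero_mul, zero_add,
    add_zero] at g0 g1 g2 g3 g4 d0 d1 d2 d3 d4
  -- Since `N 0 1 = 0`, the last three entries of rows 0 and 1 are orthogonal to the last three
  -- entries of `γ` and `δ`. They are therefore multiples, by `s` and `t`, of the cross product `(e
  -- 3 4, -e 2 4, e 2 3)`.
  obtain ⟨s, hs⟩ : ∃ s, N 0 2 = s * e 3 4 := ⟨N 0 2 / e 3 4, by simp only [he]; field_simp⟩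
  obtain ⟨t, ht⟩ : ∃ t, N 1 2 = t * e 3 4 := ⟨N 1 2 / e 3 4, by simp only [he]; field_simp⟩
  simp only [he] at hs ht
  have hs3 : N 0 3 = - s * e 2 4 := by
    apply mul_right_cancel₀ h34
    simp only [he]
    rw [hs] at g0 d0
    linear_combination δ 4 * g0 - γ 4 * d0
  have hs4 : N 0 4 = s * e 2 3 := by
    apply mul_right_cancel₀ h34
    simp only [he]
    rw [hs] at g0 d0
    linear_combination -δ 3 * g0 + γ 3 * d0
  have ht3 : N 1 3 = - t * e 2 4 := by
    apply mul_right_cancel₀ h34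
    simp only [he]
    rw [ht] at g1 d1
    linear_combination δ 4 * g1 - γ 4 * d1
  have ht4 : N 1 4 = t * e 2 3 := by
    apply mul_right_cancel₀ h34
    simp only [he]
    rw [ht] at g1 d1
    linear_combination -δ 3 * g1 + γ 3 * d1
  simp only [he] at hs3 hs4 ht3 ht4
  rw [hs, ht] at g2 d2
  rw [hs3, ht3] at g3 d3
  rw [hs4, ht4] at g4 d4
  -- the vector `μ = s ξ₀ + t ξ₁` is parallel to `ξ₂`, `ξ₃` and `ξ₄`
  set μ := s * γ 0 + t * γ 1 with hμ
  set ν := s * δ 0 + t * δ 1 with hν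
  -- Rows 2 and 3 give `N 2 3` with opposite signs, and rows 2 and 4 do the same for `N 2 4`, so
  -- both entries vanish.
  have a1 : N 2 3 = -(μ * δ 4 - ν * γ 4) := by
    apply mul_right_cancel₀ h34
    linear_combination δ 4 * g2 - γ 4 * d2
  have a2 : N 2 3 = μ * δ 4 - ν * γ 4 := by
    apply mul_right_cancel₀ h24
    linear_combination δ 4 * g3 - γ 4 * d3
  have a3 : N 2 4 = μ * δ 3 - ν * γ 3 := by
    apply mul_right_cancel₀ h34
    linear_combination -δ 3 * g2 + γ 3 * d2
  have a4 : N 2 4 = -(μ * δ 3 - ν * γ 3) := by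
    apply mul_right_cancel₀ h23
    linear_combination δ 3 * g4 - γ 3 * d4
  have b4 : μ * δ 4 - ν * γ 4 = 0 := by linarith
  have b3 : μ * δ 3 - ν * γ 3 = 0 := by linarith
  have c23 : N 2 3 = 0 := by linarith
  have c24 : N 2 4 = 0 := by linarith
  have μ0 : μ = 0 := by
    apply mul_right_cancel₀ h34
    linear_combination γ 3 * b4 - γ 4 * b3
  have ν0 : ν = 0 := by
    apply mul_right_cancel₀ h34
    linear_combination δ 3 * b4 - δ 4 * b3
  have s0 : s = 0 := by
    apply mul_right_cancel₀ h01
    linear_combination δ 1 * μ0 - γ 1 * ν0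
  have t0 : t = 0 := by
    apply mul_right_cancel₀ h01
    linear_combination -δ 0 * μ0 + γ 0 * ν0
  have c34 : N 3 4 = 0 := by
    rw [c23, s0, t0] at g3 d3
    by_contra hne
    have hg : γ 4 = 0 := by
      apply mul_left_cancel₀ hne
      linear_combination g3
    have hd : δ 4 = 0 := by
      apply mul_left_cancel₀ hne
      linear_combination d3
    exact h34 (by rw [hg, hd]; ring)
  subst s0 t0
  simp only [neg_zero, zero_mul] at hs ht hs3 hs4 ht3 ht4
  ext i j
  fin_cases i <;> fin_cases j <;>
    simp [hdiag, s10, s20, s30, s40, s21, s31, s41, s32, s42, s43, h, hs, ht, hs3, hs4, ht3, ht4,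
      c23, c24, c34]

/-- Three real numbers with zero sum that are roots of `κ t³ = (5/2) ν t² - 125/9` with `ν ≠ 0`
consist of two equal ones and a third one, say `t`, with `ν t² = 50/3`. -/
theorem exists_mul_sq_eq_of_cubic {κ ν : ℝ} (c : Fin 3 → ℝ)
    (hcub : ∀ m, κ * c m ^ 3 = 5 / 2 * (ν * c m ^ 2) - 125 / 9) (hsum : ∑ m, c m = 0) :
    ∃ m, ν * c m ^ 2 = 50 / 3 := by
  have h0 := hcub 0
  have h1 := hcub 1
  have h2 := hcub 2
  rw [Fin.sum_univ_three] at hsum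
  -- A double value `a` leaves `b = -2 a`; eliminating `κ` from the two equations gives `ν a² =
  -- 25/6`.
  have key : ∀ {a b : ℝ}, κ * a ^ 3 = 5 / 2 * (ν * a ^ 2) - 125 / 9 →
      κ * b ^ 3 = 5 / 2 * (ν * b ^ 2) - 125 / 9 → a + a + b = 0 → ν * b ^ 2 = 50 / 3 := by
    intro a b ha hb hab
    obtain rfl : b = -2 * a := by linarith
    linarith
  by_cases h01 : c 0 = c 1
  · exact ⟨2, key h0 h2 (by linarith)⟩
  by_cases h02 : c 0 = c 2
  · exact ⟨1, key h0 h1 (by linarith)⟩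
  by_cases h12 : c 1 = c 2
  · exact ⟨0, key h1 h0 (by linarith)⟩
  -- For distinct values, divided differences and the zero sum give `ν = 0`. The positive definite
  -- form in `e4` then makes `c 0` vanish, against the constant `125/9`.
  exfalso
  have e1 : κ * (c 0 ^ 2 + c 0 * c 1 + c 1 ^ 2) = 5 / 2 * ν * (c 0 + c 1) := by
    apply mul_left_cancel₀ (sub_ne_zero.mpr h01)
    linear_combination h0 - h1
  have e2 : κ * (c 0 ^ 2 + c 0 * c 2 + c 2 ^ 2) = 5 / 2 * ν * (c 0 + c 2) := by
    apply mul_left_cancel₀ (sub_ne_zero.mpr h02)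
    linear_combination h0 - h2
  have e3 : ν = 0 := by
    apply mul_left_cancel₀ (sub_ne_zero.mpr h12)
    linear_combination (-2 / 5) * (e1 - e2) + (2 / 5) * κ * (c 1 - c 2) * hsum
  subst e3
  have k0 : κ ≠ 0 := by rintro rfl; norm_num at h0
  have e4 : c 0 ^ 2 + c 0 * c 1 + c 1 ^ 2 = 0 := by
    apply mul_left_cancel₀ k0
    linear_combination e1
  have e5 : c 0 = 0 := by nlinarith [sq_nonneg (c 0 + 2 * c 1), sq_nonneg (c 0)]
  rw [e5] at h0
  norm_num at h0

open Matrix in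
/-- The real form of the classification of complex Hadamard matrices of order five: among three
vectors `α m + i β m` one has the largest possible sum of squares, in absolute value. -/
theorem exists_sq_add_sq_eq (α β : Fin 3 → Fin 5 → ℝ) (γ δ : Fin 5 → ℝ)
    (hαβ : ∀ m i, α m i ^ 2 + β m i ^ 2 = 1) (hγδ1 : ∀ i, γ i ^ 2 + δ i ^ 2 = 1)
    (hγγ : γ ⬝ᵥ γ = 5 / 2) (hδδ : δ ⬝ᵥ δ = 5 / 2) (hγδ : γ ⬝ᵥ δ = 0)
    (hαγ : ∀ m, α m ⬝ᵥ γ = 0) (hαδ : ∀ m, α m ⬝ᵥ δ = 0) (hβγ : ∀ m, β m ⬝ᵥ γ = 0)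
    (hβδ : ∀ m, β m ⬝ᵥ δ = 0)
    (hsum : ∀ i j, i ≠ j →
      ∑ m, (α m i * α m j + β m i * β m j) = -2 * (γ i * γ j + δ i * δ j))
    (h01 : γ 0 * δ 1 - γ 1 * δ 0 ≠ 0) (h23 : γ 2 * δ 3 - γ 3 * δ 2 ≠ 0)
    (h24 : γ 2 * δ 4 - γ 4 * δ 2 ≠ 0) (h34 : γ 3 * δ 4 - γ 4 * δ 3 ≠ 0) :
    ∃ m, (α m ⬝ᵥ α m - β m ⬝ᵥ β m) ^ 2 + 4 * (α m ⬝ᵥ β m) ^ 2 = 25 := by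
  have hab : ∀ m, α m ⬝ᵥ α m + β m ⬝ᵥ β m = 5 := by
    intro m
    rw [dotProduct, dotProduct, ← Finset.sum_add_distrib,
      Finset.sum_congr rfl fun i _ => show α m i * α m i + β m i * β m i = 1 by
        linarith [hαβ m i]]
    simp
  -- The coefficient `2/3` makes the three matrices sum to zero off the diagonal. Then `5/3` is both
  -- `1 + 2/3`, which clears the diagonal, and `(2/3)(5/2)`, which makes `γ` and `δ` null vectors.
  set N : Fin 3 → Matrix (Fin 5) (Fin 5) ℝ := fun m => deviationMatrix (α m) (β m) γ δ with hN
  have hsymm : ∀ m i j, N m i j = N m j i := by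
    intro m i j
    simp only [hN, deviationMatrix_apply, eq_comm (a := i)]
    ring
  have hdiag : ∀ m i, N m i i = 0 := by
    intro m i
    simp only [hN, deviationMatrix_apply, if_true]
    linarith [hαβ m i, hγδ1 i]
  have hNv : ∀ m (v : Fin 5 → ℝ), α m ⬝ᵥ v = 0 → β m ⬝ᵥ v = 0 →
      ∀ i, ∑ j, N m i j * v j = 2 / 3 * (γ i * (γ ⬝ᵥ v) + δ i * (δ ⬝ᵥ v)) - 5 / 3 * v i := by
    intro m v h1 h2 i
    have : ∑ j, N m i j * v j = α m i * (α m ⬝ᵥ v) + β m i * (β m ⬝ᵥ v) +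
        2 / 3 * (γ i * (γ ⬝ᵥ v) + δ i * (δ ⬝ᵥ v)) - 5 / 3 * v i := by
      have : ∑ j, (if i = j then 1 else 0) * v j = v i := by simp
      simp only [hN, deviationMatrix_apply, dotProduct, Finset.mul_sum, ← Finset.sum_add_distrib]
      rw [← this]
      rw [Finset.mul_sum, ← Finset.sum_sub_distrib]
      exact Finset.sum_congr rfl fun j _ => by ring
    rw [this, h1, h2]
    ring
  have hNγ : ∀ m i, ∑ j, N m i j * γ j = 0 := by
    intro m i
    rw [hNv m γ (hαγ m) (hβγ m), hγγ, dotProduct_comm, hγδ]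
    ring
  have hNδ : ∀ m i, ∑ j, N m i j * δ j = 0 := by
    intro m i
    rw [hNv m δ (hαδ m) (hβδ m), hδδ, hγδ]
    ring
  have hNsum : ∀ i j, ∑ m, N m i j = 0 := by
    intro i j
    rcases eq_or_ne i j with rfl | hij
    · simp [hdiag]
    · have := hsum i j hij
      simp only [hN, deviationMatrix_apply, if_neg hij, Fin.sum_univ_three] at this ⊢
      linarith
  -- The space of such matrices has dimension at most one, with the entry at `(0, 1)` as coordinate.
  obtain ⟨K, hK⟩ : ∃ K : Matrix (Fin 5) (Fin 5) ℝ, ∀ m, N m = N m 0 1 • K := by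
    have uniq := fun m => eq_zero_of_apply_zero_one_eq_zero (N m) γ δ (hsymm m) (hdiag m) (hNγ m)
      (hNδ m) h01 h23 h24 h34
    by_cases hall : ∀ m, N m 0 1 = 0
    · exact ⟨0, fun m => by rw [uniq m (hall m), smul_zero]⟩
    · push Not at hall
      obtain ⟨n, hn⟩ := hall
      refine ⟨(N n 0 1)⁻¹ • N n, fun m => ?_⟩
      have hz : N n 0 1 • N m - N m 0 1 • N n = 0 := by
        refine eq_zero_of_apply_zero_one_eq_zero _ γ δ ?_ ?_ ?_ ?_ h01 h23 h24 h34 ?_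
        · intro i j
          simp [hsymm m i j, hsymm n i j]
        · intro i
          simp [hdiag]
        · intro i
          simp only [Matrix.sub_apply, Matrix.smul_apply, smul_eq_mul, sub_mul, mul_assoc,
            Finset.sum_sub_distrib, ← Finset.mul_sum, hNγ]
          ring
        · intro i
          simp only [Matrix.sub_apply, Matrix.smul_apply, smul_eq_mul, sub_mul, mul_assoc,
            Finset.sum_sub_distrib, ← Finset.mul_sum, hNδ]
          ring
        · simp only [Matrix.sub_apply, Matrix.smul_apply, smul_eq_mul]
          ring
      rw [smul_comm, ← sub_eq_zero.mp hz, smul_smul, inv_mul_cancel₀ hn, one_smul]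
  have t2 : ∀ m, (N m * N m).trace = (K * K).trace * N m 0 1 ^ 2 := by
    intro m
    conv_lhs => rw [hK m]
    simp only [smul_mul_assoc, mul_smul_comm, trace_smul, smul_eq_mul]
    ring
  have t3 : ∀ m, (N m * N m * N m).trace = (K * K * K).trace * N m 0 1 ^ 3 := by
    intro m
    conv_lhs => rw [hK m]
    simp only [smul_mul_assoc, mul_smul_comm, trace_smul, smul_eq_mul]
    ring
  obtain ⟨m, hm⟩ := exists_mul_sq_eq_of_cubic (κ := (K * K * K).trace) (ν := (K * K).trace)
    (fun m => N m 0 1) (fun m => by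
      rw [← t2, ← t3]
      exact trace_deviationMatrix_cube (hαγ m) (hαδ m) (hβγ m) (hβδ m) hγγ hδδ hγδ (hab m))
    (hNsum 0 1)
  refine ⟨m, ?_⟩
  have := trace_deviationMatrix_sq (hαγ m) (hαδ m) (hβγ m) (hβδ m) hγγ hδδ hγδ (hab m)
  rw [show deviationMatrix (α m) (β m) γ δ = N m from rfl, t2, hm] at this
  linarith

/-! ### Complex Hadamard matrices of order five -/

theorem exists_perm_apply_eq_and_apply_eq {ι : Type*} [DecidableEq ι] {a b i j : ι} (hab : a ≠ b)
    (hij : i ≠ j) : ∃ σ : Equiv.Perm ι, σ a = i ∧ σ b = j := by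
  set τ := Equiv.swap a i with hτ
  have hne : τ j ≠ a := by
    intro h
    have : j = τ a := by rw [← h, hτ, Equiv.swap_apply_self]
    exact hij (by rw [this, hτ, Equiv.swap_apply_left])
  refine ⟨τ * Equiv.swap b (τ j), ?_, ?_⟩
  · rw [Equiv.Perm.mul_apply, Equiv.swap_apply_of_ne_of_ne hab hne.symm, hτ, Equiv.swap_apply_left]
  · rw [Equiv.Perm.mul_apply, Equiv.swap_apply_left, hτ, Equiv.swap_apply_self]

theorem Complex.mul_conj_eq_one {z : ℂ} (hz : ‖z‖ = 1) : z * conj z = 1 := by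
  rw [Complex.mul_conj, Complex.normSq_eq_norm_sq, hz]
  simp

theorem Complex.conj_mul_eq_one {z : ℂ} (hz : ‖z‖ = 1) : conj z * z = 1 := by
  rw [mul_comm, Complex.mul_conj_eq_one hz]

theorem Complex.re_sq_add_im_sq {z : ℂ} (hz : ‖z‖ = 1) : z.re ^ 2 + z.im ^ 2 = 1 := by
  have := Complex.normSq_eq_norm_sq z
  rw [hz, Complex.normSq_apply] at this
  linarith

/-- The minor is the imaginary part of `conj z * w`, which vanishes for unimodular numbers only if
`w = ± z`. -/
theorem Complex.minor_ne_zero_of_sq_ne_sq {z w : ℂ} (hz : ‖z‖ = 1) (hw : ‖w‖ = 1)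
    (h : z ^ 2 ≠ w ^ 2) : z.re * w.im - w.re * z.im ≠ 0 := by
  intro h0
  apply h
  have h1 := Complex.re_sq_add_im_sq hz
  have h2 := Complex.re_sq_add_im_sq hw
  apply Complex.ext
  · simp only [pow_two, Complex.mul_re]
    have h3 : (z.re * w.im) ^ 2 = (w.re * z.im) ^ 2 := by rw [sub_eq_zero.mp h0]
    have h4 : z.im ^ 2 = 1 - z.re ^ 2 := by linarith
    have h5 : w.im ^ 2 = 1 - w.re ^ 2 := by linarith
    rw [mul_pow, mul_pow, h4, h5] at h3
    nlinarith
  · simp only [pow_two, Complex.mul_im]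
    have h3 : z.re * w.im = w.re * z.im := sub_eq_zero.mp h0
    have : z.re * z.im = w.re * w.im := by
      calc z.re * z.im = z.re * z.im * (w.re ^ 2 + w.im ^ 2) := by rw [h2, mul_one]
        _ = w.re * w.im * (z.re ^ 2 + z.im ^ 2) := by
          linear_combination (z.im * w.im - z.re * w.re) * h3
        _ = w.re * w.im := by rw [h1, mul_one]
    linarith

/-- Unimodular vectors `x`, `y 0`, `y 1`, `y 2` that form, together with the constant vector `1`,
an orthogonal basis of `ℂ⁵`: some `y m` has zero sum of squares. -/
theorem exists_sum_sq_eq_zero_of_ne (x : Fin 5 → ℂ) (y : Fin 3 → Fin 5 → ℂ) (hx : ∀ k, ‖x k‖ = 1)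
    (hy : ∀ m k, ‖y m k‖ = 1) (hsx : ∑ k, x k = 0) (hsy : ∀ m, ∑ k, y m k = 0)
    (hxy : ∀ m, ∑ k, y m k * conj (x k) = 0)
    (hcol : ∀ i j, i ≠ j → 1 + x i * conj (x j) + ∑ m, y m i * conj (y m j) = 0)
    (h01 : x 0 ≠ x 1) (h23 : x 2 ≠ x 3) (h24 : x 2 ≠ x 4) (h34 : x 3 ≠ x 4) :
    ∃ m, ∑ k, y m k ^ 2 = 0 := by
  -- With `x = ξ²` and `η = y conj ξ`, orthogonality of `y` to `1` and to `x` becomes orthogonality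
  -- of `η` to `conj ξ` and to `ξ`. Hence it splits into real orthogonality relations between real
  -- and imaginary parts.
  choose ξ hξ using fun k => IsAlgClosed.exists_pow_nat_eq (x k) (n := 2) (by norm_num)
  have nξ : ∀ k, ‖ξ k‖ = 1 := by
    intro k
    have := hx k
    rw [← hξ, norm_pow] at this
    exact (pow_eq_one_iff_of_nonneg (norm_nonneg _) two_ne_zero).mp this
  set η : Fin 3 → Fin 5 → ℂ := fun m k => y m k * conj (ξ k) with hη
  have nη : ∀ m k, ‖η m k‖ = 1 := by
    intro m k
    simp [hη, hy, nξ]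
  have hyη : ∀ m k, y m k = η m k * ξ k := by
    intro m k
    simp only [hη]
    rw [mul_assoc, Complex.conj_mul_eq_one (nξ k), mul_one]
  have e1 : ∑ k, ξ k ^ 2 = 0 := by simpa only [hξ] using hsx
  have e2 : ∀ m, ∑ k, η m k * ξ k = 0 := fun m => by simpa only [← hyη] using hsy m
  have e3 : ∀ m, ∑ k, η m k * conj (ξ k) = 0 := by
    intro m
    rw [← hxy m]
    refine Finset.sum_congr rfl fun k _ => ?_
    rw [hyη, ← hξ, map_pow]
    linear_combination -η m k * conj (ξ k) * Complex.conj_mul_eq_one (nξ k)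
  have q1 := congrArg Complex.re e1
  have q2 := congrArg Complex.im e1
  simp only [Complex.re_sum, Complex.im_sum, pow_two, Complex.mul_re, Complex.mul_im,
    Complex.zero_re, Complex.zero_im] at q1 q2
  have q3 : ∑ k, ((ξ k).re * (ξ k).re + (ξ k).im * (ξ k).im) = 5 := by
    rw [Finset.sum_congr rfl fun k _ => show (ξ k).re * (ξ k).re + (ξ k).im * (ξ k).im = 1 by
      linarith [Complex.re_sq_add_im_sq (nξ k)]]
    simp
  rw [Finset.sum_sub_distrib] at q1
  rw [Finset.sum_add_distrib] at q2 q3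
  have q4 : ∑ k, (ξ k).im * (ξ k).re = ∑ k, (ξ k).re * (ξ k).im :=
    Finset.sum_congr rfl fun k _ => mul_comm _ _
  have r1 := fun m => congrArg Complex.re (e2 m)
  have r2 := fun m => congrArg Complex.im (e2 m)
  have r3 := fun m => congrArg Complex.re (e3 m)
  have r4 := fun m => congrArg Complex.im (e3 m)
  simp only [Complex.re_sum, Complex.im_sum, Complex.mul_re, Complex.mul_im, Complex.conj_re,
    Complex.conj_im, Complex.zero_re, Complex.zero_im, Finset.sum_sub_distrib,
    Finset.sum_add_distrib, mul_neg, Finset.sum_neg_distrib] at r1 r2 r3 r4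
  obtain ⟨m, hm⟩ := exists_sq_add_sq_eq (fun m k => (η m k).re) (fun m k => (η m k).im)
    (fun k => (ξ k).re) (fun k => (ξ k).im) (fun m k => Complex.re_sq_add_im_sq (nη m k))
    (fun k => Complex.re_sq_add_im_sq (nξ k)) (by simp only [dotProduct]; linarith)
    (by simp only [dotProduct]; linarith) (by simp only [dotProduct]; linarith)
    (fun m => by simp only [dotProduct]; linarith [r1 m, r3 m])
    (fun m => by simp only [dotProduct]; linarith [r2 m, r4 m])
    (fun m => by simp only [dotProduct]; linarith [r2 m, r4 m])
    (fun m => by simp only [dotProduct]; linarith [r1 m, r3 m])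
    (fun i j hij => by
      have h := hcol i j hij
      have h' : ∑ m, η m i * conj (η m j) = -(conj (ξ i) * ξ j + ξ i * conj (ξ j)) := by
        have : ∑ m, η m i * conj (η m j) = conj (ξ i) * ξ j * ∑ m, y m i * conj (y m j) := by
          rw [Finset.mul_sum]
          refine Finset.sum_congr rfl fun m _ => ?_
          simp only [hη, map_mul, Complex.conj_conj]
          ring
        rw [this, eq_neg_of_add_eq_zero_right h, ← hξ i, ← hξ j, map_pow]
        have a := Complex.conj_mul_eq_one (nξ i)
        have b := Complex.mul_conj_eq_one (nξ j)
        linear_combination -ξ i * conj (ξ j) * a - (conj (ξ i) * ξ i) * ξ i * conj (ξ j) * b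
      have h'' := congrArg Complex.re h'
      simp only [Complex.re_sum, Complex.mul_re, Complex.conj_re, Complex.conj_im, Complex.neg_re,
        Complex.add_re] at h''
      rw [Finset.sum_congr rfl fun m _ => show (η m i).re * (η m j).re + (η m i).im * (η m j).im =
        (η m i).re * (η m j).re - (η m i).im * -(η m j).im by ring, h'']
      ring)
    (Complex.minor_ne_zero_of_sq_ne_sq (nξ _) (nξ _) (by rwa [hξ, hξ]))
    (Complex.minor_ne_zero_of_sq_ne_sq (nξ _) (nξ _) (by rwa [hξ, hξ]))
    (Complex.minor_ne_zero_of_sq_ne_sq (nξ _) (nξ _) (by rwa [hξ, hξ]))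
    (Complex.minor_ne_zero_of_sq_ne_sq (nξ _) (nξ _) (by rwa [hξ, hξ]))
  refine ⟨m, ?_⟩
  simp only [dotProduct] at hm
  have s1 : ∑ k, ((η m k).re * (η m k).re + (η m k).im * (η m k).im) = 5 := by
    rw [Finset.sum_congr rfl fun k _ => show (η m k).re * (η m k).re + (η m k).im * (η m k).im = 1
      by linarith [Complex.re_sq_add_im_sq (nη m k)]]
    simp
  rw [Finset.sum_add_distrib] at s1
  -- By Lagrange's identity, `hm` and `s1` express equality in the Cauchy-Schwarz inequality: the
  -- real and imaginary parts of `η m` are parallel, so all `η m k ^ 2` coincide and `y m k ^ 2` is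
  -- a constant multiple of `x k`.
  have s2 : ∑ k, ∑ l, ((η m k).re * (η m l).im - (η m l).re * (η m k).im) ^ 2 = 0 := by
    have : ∑ k, ∑ l, ((η m k).re * (η m l).im - (η m l).re * (η m k).im) ^ 2 =
        2 * ((∑ k, (η m k).re * (η m k).re) * (∑ k, (η m k).im * (η m k).im) -
          (∑ k, (η m k).re * (η m k).im) ^ 2) := by
      simp only [Fin.sum_univ_five]
      ring
    rw [this]
    have : ((∑ k, (η m k).re * (η m k).re) + ∑ k, (η m k).im * (η m k).im) ^ 2 = 25 := by
      rw [s1]; norm_num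
    nlinarith
  have s3 : ∀ k, η m k ^ 2 = η m 0 ^ 2 := by
    intro k
    by_contra hne
    apply Complex.minor_ne_zero_of_sq_ne_sq (nη m k) (nη m 0) hne
    have h1 := (Finset.sum_eq_zero_iff_of_nonneg
      (fun k _ => Finset.sum_nonneg fun l _ => sq_nonneg _)).mp s2 k (Finset.mem_univ _)
    have h2 := (Finset.sum_eq_zero_iff_of_nonneg (fun l _ => sq_nonneg _)).mp h1 0
      (Finset.mem_univ _)
    exact pow_eq_zero_iff two_ne_zero |>.mp h2
  simp only [hyη, mul_pow, s3]
  rw [← Finset.mul_sum, e1, mul_zero]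

/-- Three equal entries would add up to modulus 3, which the other two cannot cancel. -/
theorem three_ne_of_sum_eq_zero (x : Fin 5 → ℂ) (hx : ∀ k, ‖x k‖ = 1) (hsx : ∑ k, x k = 0)
    {i j k : Fin 5} (hij : i ≠ j) (hik : i ≠ k) (hjk : j ≠ k) (h1 : x i = x j) : x i ≠ x k := by
  intro h2
  have hc : (Finset.univ \ {i, j, k} : Finset (Fin 5)).card = 2 := by
    rw [Finset.card_sdiff_of_subset (Finset.subset_univ _), Finset.card_eq_three.mpr
      ⟨i, j, k, hij, hik, hjk, rfl⟩]
    simp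
  rw [← Finset.sum_sdiff (Finset.subset_univ {i, j, k})] at hsx
  have h3 : ∑ l ∈ ({i, j, k} : Finset (Fin 5)), x l = 3 * x i := by
    rw [Finset.sum_insert (by simp [hij, hik]), Finset.sum_pair hjk, ← h1, ← h2]
    ring
  rw [h3] at hsx
  have h4 : ‖∑ l ∈ (Finset.univ \ {i, j, k} : Finset (Fin 5)), x l‖ ≤ 2 := by
    refine (norm_sum_le _ _).trans ?_
    rw [Finset.sum_congr rfl fun l _ => hx l]
    simp [hc]
  rw [eq_neg_of_add_eq_zero_left hsx, norm_neg, norm_mul, hx] at h4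
  norm_num at h4

/-- The inequalities are those that make the four minors of `ξ` nonzero. They can be arranged
because no value occurs three times. -/
theorem exists_perm_ne (x : Fin 5 → ℂ) (hx : ∀ k, ‖x k‖ = 1) (hsx : ∑ k, x k = 0) :
    ∃ σ : Equiv.Perm (Fin 5), x (σ 0) ≠ x (σ 1) ∧ x (σ 2) ≠ x (σ 3) ∧ x (σ 2) ≠ x (σ 4) ∧
      x (σ 3) ≠ x (σ 4) := by
  by_cases hinj : Function.Injective x
  · exact ⟨1, hinj.ne (by decide), hinj.ne (by decide), hinj.ne (by decide), hinj.ne (by decide)⟩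
  · simp only [Function.Injective] at hinj
    push Not at hinj
    obtain ⟨i, j, hxij, hij⟩ := hinj
    obtain ⟨σ, hi, hj⟩ := exists_perm_apply_eq_and_apply_eq (show (0 : Fin 5) ≠ 2 by decide) hij
    have three := fun {a b c : Fin 5} (hab : a ≠ b) (hac : a ≠ c) (hbc : b ≠ c) =>
      three_ne_of_sum_eq_zero x hx hsx (σ.injective.ne hab) (σ.injective.ne hac)
        (σ.injective.ne hbc)
    have h02 : x (σ 0) = x (σ 2) := by rw [hi, hj, hxij]
    have h01 : x (σ 0) ≠ x (σ 1) := three (by decide) (by decide) (by decide) h02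
    have h03 : x (σ 0) ≠ x (σ 3) := three (by decide) (by decide) (by decide) h02
    have h04 : x (σ 0) ≠ x (σ 4) := three (by decide) (by decide) (by decide) h02
    by_cases h34 : x (σ 3) = x (σ 4)
    · have h31 : x (σ 3) ≠ x (σ 1) := three (by decide) (by decide) (by decide) h34
      -- There are two equal pairs: the first sits at 0 and 2, and the swap moves the second from 3
      -- and 4 to 1 and 4.
      refine ⟨σ * Equiv.swap 1 3, ?_⟩
      have t0 : Equiv.swap (1 : Fin 5) 3 0 = 0 := by decide
      have t2 : Equiv.swap (1 : Fin 5) 3 2 = 2 := by decide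
      have t4 : Equiv.swap (1 : Fin 5) 3 4 = 4 := by decide
      simp only [Equiv.Perm.mul_apply, Equiv.swap_apply_left, Equiv.swap_apply_right, t0, t2, t4]
      exact ⟨h03, h02 ▸ h01, h02 ▸ h04, h34 ▸ h31.symm⟩
    · exact ⟨σ, h01, h02 ▸ h03, h02 ▸ h04, h34⟩

/-- Every complex Hadamard matrix of order five has two rows whose quotient has zero sum of
squares. -/
theorem exists_sum_sq_eq_zero (H : Fin 5 → Fin 5 → ℂ) (hn : ∀ i k, ‖H i k‖ = 1)
    (ho : ∀ i j, i ≠ j → ∑ k, H i k * conj (H j k) = 0) :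
    ∃ i j, i ≠ j ∧ ∑ k, (H i k * conj (H j k)) ^ 2 = 0 := by
  -- Up to the factor `1/5`, the conjugate transpose is a right inverse, hence a left inverse.
  have hcol : ∀ k l, k ≠ l → ∑ i, H i k * conj (H i l) = 0 := by
    intro k l hkl
    let M : Matrix (Fin 5) (Fin 5) ℂ := Matrix.of H
    have h1 : M * ((1 / 5 : ℂ) • M.conjTranspose) = 1 := by
      ext i j
      rw [Matrix.mul_smul, Matrix.smul_apply, Matrix.mul_apply]
      simp only [Matrix.conjTranspose_apply, RCLike.star_def, M, Matrix.of_apply, smul_eq_mul]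
      rcases eq_or_ne i j with rfl | hij
      · simp [Complex.mul_conj_eq_one (hn i _)]
      · rw [ho i j hij, Matrix.one_apply_ne hij, mul_zero]
    have h2 := Matrix.ext_iff.mpr (mul_eq_one_comm.mp h1) l k
    rw [Matrix.smul_mul, Matrix.smul_apply, Matrix.mul_apply, Matrix.one_apply_ne hkl.symm] at h2
    simp only [Matrix.conjTranspose_apply, RCLike.star_def, M, Matrix.of_apply, smul_eq_mul] at h2
    rw [← (mul_eq_zero.mp h2).resolve_left (by norm_num)]
    exact Finset.sum_congr rfl fun i _ => mul_comm _ _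
  set G : Fin 5 → Fin 5 → ℂ := fun i k => H i k * conj (H 0 k) with hG
  have nG : ∀ i k, ‖G i k‖ = 1 := fun i k => by simp [hG, hn]
  have sG : ∀ i, i ≠ 0 → ∑ k, G i k = 0 := fun i hi => ho i 0 hi
  obtain ⟨σ, a1, a2, a3, a4⟩ := exists_perm_ne (G 1) (nG 1) (sG 1 (by decide))
  have hs : ∀ f : Fin 5 → ℂ, ∑ k, f (σ k) = ∑ k, f k := fun f => Equiv.sum_comp σ f
  let r : Fin 3 → Fin 5 := ![2, 3, 4]
  have r0 : ∀ m, r m ≠ 0 := by decide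
  have r1 : ∀ m, r m ≠ 1 := by decide
  obtain ⟨m, hm⟩ := exists_sum_sq_eq_zero_of_ne (fun k => G 1 (σ k)) (fun m k => G (r m) (σ k))
    (fun k => nG _ _) (fun m k => nG _ _) ((hs _).trans (sG 1 (by decide)))
    (fun m => (hs _).trans (sG _ (r0 m)))
    (fun m => by
      rw [hs fun k => G (r m) k * conj (G 1 k), ← ho (r m) 1 (r1 m)]
      refine Finset.sum_congr rfl fun k _ => ?_
      simp only [hG, map_mul, Complex.conj_conj]
      linear_combination H (r m) k * conj (H 1 k) * Complex.mul_conj_eq_one (hn 0 k))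
    (fun i j hij => by
      have h := hcol (σ i) (σ j) (σ.injective.ne hij)
      rw [Fin.sum_univ_five] at h
      simp only [Fin.sum_univ_three, hG, r, Matrix.cons_val, map_mul, Complex.conj_conj]
      have c1 := Complex.mul_conj_eq_one (hn 0 (σ i))
      have c2 := Complex.mul_conj_eq_one (hn 0 (σ j))
      linear_combination conj (H 0 (σ i)) * H 0 (σ j) * h -
        H 0 (σ j) * conj (H 0 (σ j)) * c1 - c2) a1 a2 a3 a4
  refine ⟨r m, 0, r0 m, ?_⟩
  rwa [hs fun k => G (r m) k ^ 2] at hm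

/-! ### Vanishing sums of three or five unimodular numbers -/

/-- Five unimodular numbers with zero sum and zero sum of squares form a coset of the fifth roots
of unity. -/
theorem injective_and_pow_five (w : Fin 5 → ℂ) (hw : ∀ k, ‖w k‖ = 1) (h1 : ∑ k, w k = 0)
    (h2 : ∑ k, w k ^ 2 = 0) : Function.Injective w ∧ ∀ i j, w i ^ 5 = w j ^ 5 := by
  have key : ∀ v : Fin 5 → ℂ, (∀ k, ‖v k‖ = 1) → ∑ k, v k = 0 → ∑ k, v k ^ 2 = 0 →
      v 0 ≠ v 1 ∧ v 0 ^ 5 = v 1 ^ 5 := by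
    intro v hv h1 h2
    have hc := fun k => Complex.mul_conj_eq_one (hv k)
    have hinv : ∀ k, conj (v k) = (v k)⁻¹ := fun k => (inv_eq_of_mul_eq_one_right (hc k)).symm
    have hne : ∀ k, v k ≠ 0 := fun k h => by simpa [h] using hc k
    -- Conjugation inverts the entries, so the power sums of the inverses vanish too. Newton's
    -- identities then kill the elementary symmetric functions of degrees 1 to 4, and the entries
    -- are the roots of some `X⁵ - c` with `c ≠ 0`.
    have h3 : ∑ k, (v k)⁻¹ = 0 := by
      simpa only [map_sum, hinv, map_zero] using congrArg conj h1
    have h4 : ∑ k, ((v k)⁻¹) ^ 2 = 0 := by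
      simpa only [map_sum, map_pow, hinv, map_zero] using congrArg conj h2
    rw [Fin.sum_univ_five] at h1 h2 h3 h4
    have na := hne 0
    have nb := hne 1
    have nc := hne 2
    have nd := hne 3
    have ne := hne 4
    clear hc hinv hne hv
    generalize v 0 = a at *
    generalize v 1 = b at *
    generalize v 2 = c at *
    generalize v 3 = d at *
    generalize v 4 = e at *
    have e2 : a * b + a * c + a * d + a * e + b * c + b * d + b * e + c * d + c * e + d * e = 0 := by
      linear_combination (1 / 2) * (a + b + c + d + e) * h1 - (1 / 2) * h2
    have e4 : b * c * d * e + a * c * d * e + a * b * d * e + a * b * c * e + a * b * c * d = 0 := by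
      have : b * c * d * e + a * c * d * e + a * b * d * e + a * b * c * e + a * b * c * d =
          a * b * c * d * e * (a⁻¹ + b⁻¹ + c⁻¹ + d⁻¹ + e⁻¹) := by
        field_simp
      rw [this, h3, mul_zero]
    have e3 : a * b * c + a * b * d + a * b * e + a * c * d + a * c * e + a * d * e + b * c * d +
        b * c * e + b * d * e + c * d * e = 0 := by
      have : a * b * c + a * b * d + a * b * e + a * c * d + a * c * e + a * d * e + b * c * d +
          b * c * e + b * d * e + c * d * e = a * b * c * d * e * (1 / 2) *
            ((a⁻¹ + b⁻¹ + c⁻¹ + d⁻¹ + e⁻¹) ^ 2 -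
              (a⁻¹ ^ 2 + b⁻¹ ^ 2 + c⁻¹ ^ 2 + d⁻¹ ^ 2 + e⁻¹ ^ 2)) := by
        field_simp
        ring
      rw [this, h3, h4]
      ring
    constructor
    · rintro rfl
      have : 5 * a ^ 4 = 0 := by
        linear_combination 4 * a ^ 3 * h1 - 3 * a ^ 2 * e2 + 2 * a * e3 - e4
      exact na (pow_eq_zero_iff four_ne_zero |>.mp (by linear_combination (1 / 5) * this))
    · linear_combination (a ^ 4 - b ^ 4) * h1 - (a ^ 3 - b ^ 3) * e2 + (a ^ 2 - b ^ 2) * e3 -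
        (a - b) * e4
  have pair : ∀ i j, i ≠ j → w i ≠ w j ∧ w i ^ 5 = w j ^ 5 := by
    intro i j hij
    obtain ⟨σ, rfl, rfl⟩ := exists_perm_apply_eq_and_apply_eq (show (0 : Fin 5) ≠ 1 by decide) hij
    exact key (fun k => w (σ k)) (fun k => hw _) ((Equiv.sum_comp σ w).trans h1)
      ((Equiv.sum_comp σ fun k => w k ^ 2).trans h2)
  refine ⟨fun i j h => by_contra fun hij => (pair i j hij).1 h, fun i j => ?_⟩
  rcases eq_or_ne i j with rfl | hij
  · rfl
  · exact (pair i j hij).2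

/-- Conjugating the zero sum kills the second elementary symmetric function, so the entries are the
roots of some `X³ - c`; no condition on squares is needed. -/
theorem injective_and_pow_three (w : Fin 3 → ℂ) (hw : ∀ k, ‖w k‖ = 1) (h1 : ∑ k, w k = 0) :
    Function.Injective w ∧ ∀ i j, w i ^ 3 = w j ^ 3 := by
  have key : ∀ v : Fin 3 → ℂ, (∀ k, ‖v k‖ = 1) → ∑ k, v k = 0 → v 0 ≠ v 1 ∧ v 0 ^ 3 = v 1 ^ 3 := by
    intro v hv h1
    have hc := fun k => Complex.mul_conj_eq_one (hv k)
    have hinv : ∀ k, conj (v k) = (v k)⁻¹ := fun k => (inv_eq_of_mul_eq_one_right (hc k)).symm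
    have hne : ∀ k, v k ≠ 0 := fun k h => by simpa [h] using hc k
    have h3 : ∑ k, (v k)⁻¹ = 0 := by
      simpa only [map_sum, hinv, map_zero] using congrArg conj h1
    rw [Fin.sum_univ_three] at h1 h3
    have na := hne 0
    have nb := hne 1
    have nc := hne 2
    clear hc hinv hne hv
    generalize v 0 = a at *
    generalize v 1 = b at *
    generalize v 2 = c at *
    have e2 : a * b + a * c + b * c = 0 := by
      have : a * b + a * c + b * c = a * b * c * (a⁻¹ + b⁻¹ + c⁻¹) := by
        field_simp
        ring
      rw [this, h3, mul_zero]
    constructor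
    · rintro rfl
      have : 3 * a ^ 2 = 0 := by linear_combination 2 * a * h1 - e2
      exact na (pow_eq_zero_iff two_ne_zero |>.mp (by linear_combination (1 / 3) * this))
    · linear_combination (a ^ 2 - b ^ 2) * h1 - (a - b) * e2
  have pair : ∀ i j, i ≠ j → w i ≠ w j ∧ w i ^ 3 = w j ^ 3 := by
    intro i j hij
    obtain ⟨σ, rfl, rfl⟩ := exists_perm_apply_eq_and_apply_eq (show (0 : Fin 3) ≠ 1 by decide) hij
    exact key (fun k => w (σ k)) (fun k => hw _) ((Equiv.sum_comp σ w).trans h1)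
  refine ⟨fun i j h => by_contra fun hij => (pair i j hij).1 h, fun i j => ?_⟩
  rcases eq_or_ne i j with rfl | hij
  · rfl
  · exact (pair i j hij).2

/-! ### Tilings of abelian groups from characters -/

section Discrete

variable {G : Type*} [AddCommGroup G]

theorem AddChar.coe_div_apply (χ ψ : AddChar G Circle) (a : G) :
    ((χ / ψ) a : ℂ) = χ a * conj (ψ a : ℂ) := by
  rw [AddChar.div_apply', Circle.coe_div, div_eq_mul_inv, ← Circle.coe_inv, Circle.coe_inv_eq_conj]

theorem AddChar.coe_sub_apply_div (χ : AddChar G Circle) (a b : G) :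
    (χ (a - b) : ℂ) = χ a / χ b := by
  rw [AddChar.map_sub_eq_div, Circle.coe_div]

/-- If a character maps `n` points injectively into a coset of the `n`-th roots of unity, then
these points tile the group. -/
theorem exists_tiling_of_pow_eq {n : ℕ} (p : Fin n → G) (hn : 0 < n) (χ : AddChar G Circle)
    (hinj : Function.Injective fun k => (χ (p k) : ℂ))
    (hpow : ∀ i j, (χ (p i) : ℂ) ^ n = (χ (p j) : ℂ) ^ n) :
    ∃ T : Set G, ∀ z, ∃! k, z - p k ∈ T := by
  classical
  set f : ℂ → ℂ := fun k => k ^ n with hf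
  let o : Fin n := ⟨0, hn⟩
  have hne : ∀ z, (χ z : ℂ) ≠ 0 := fun z => Circle.coe_ne_zero _
  have hsurj : ∀ c : ℂ, c ^ n = (χ (p o) : ℂ) ^ n → ∃ k, (χ (p k) : ℂ) = c := by
    intro c hc
    have hsub : Finset.univ.image (fun k => (χ (p k) : ℂ)) ⊆
        (Polynomial.nthRoots n ((χ (p o) : ℂ) ^ n)).toFinset := by
      intro x hx
      obtain ⟨k, -, rfl⟩ := Finset.mem_image.mp hx
      rw [Multiset.mem_toFinset, Polynomial.mem_nthRoots hn]
      exact hpow k o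
    have hcard : (Polynomial.nthRoots n ((χ (p o) : ℂ) ^ n)).toFinset.card ≤
        (Finset.univ.image (fun k => (χ (p k) : ℂ))).card := by
      rw [Finset.card_image_of_injective _ hinj, Finset.card_univ, Fintype.card_fin]
      exact (Multiset.toFinset_card_le _).trans (Polynomial.card_nthRoots _ _)
    have hmem : c ∈ Finset.univ.image (fun k => (χ (p k) : ℂ)) := by
      rw [Finset.eq_of_subset_of_card_le hsub hcard, Multiset.mem_toFinset,
        Polynomial.mem_nthRoots hn]
      exact hc
    obtain ⟨k, -, hk⟩ := Finset.mem_image.mp hmem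
    exact ⟨k, hk⟩
  -- `Function.invFun f` chooses one `n`-th root for each value. All `χ (z - p k)` have the same
  -- `n`-th power and run through all its roots, so exactly one of them is the chosen root.
  refine ⟨{t | Function.invFun f (f (χ t)) = χ t}, fun z => ?_⟩
  have hfz : ∀ k, f (χ (z - p k)) = f (χ (z - p o)) := by
    intro k
    simp only [hf, AddChar.coe_sub_apply_div, div_pow, hpow k o]
  set u := Function.invFun f (f (χ (z - p o))) with hu
  have hfu : f u = f (χ (z - p o)) := Function.invFun_eq ⟨_, rfl⟩
  have u0 : u ≠ 0 := by
    intro h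
    rw [h] at hfu
    simp only [hf, zero_pow hn.ne'] at hfu
    exact pow_ne_zero _ (hne _) hfu.symm
  have hmem : ∀ k, z - p k ∈ {t | Function.invFun f (f (χ t)) = χ t} ↔ (χ (p k) : ℂ) = χ z / u := by
    intro k
    rw [Set.mem_ofPred_eq, hfz, ← hu, AddChar.coe_sub_apply_div, eq_div_iff (hne _), eq_div_iff u0,
      mul_comm]
  obtain ⟨k, hk⟩ := hsurj (χ z / u) (by
    have : u ^ n = ((χ z : ℂ) / χ (p o)) ^ n := by
      rw [← AddChar.coe_sub_apply_div]
      exact hfu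
    rw [div_pow, this, div_pow, div_div_cancel₀ (pow_ne_zero _ (hne _))])
  exact ⟨k, (hmem k).mpr hk, fun l hl => hinj (((hmem l).mp hl).trans hk.symm)⟩

theorem exists_tiling_perm {n : ℕ} (p : Fin n → G) (σ : Equiv.Perm (Fin n))
    (h : ∃ T : Set G, ∀ z, ∃! k, z - p (σ k) ∈ T) : ∃ T : Set G, ∀ z, ∃! k, z - p k ∈ T := by
  obtain ⟨T, hT⟩ := h
  exact ⟨T, fun z => (σ.existsUnique_congr fun {k} => Iff.rfl).mp (hT z)⟩

/-- A set containing exactly one of `z`, `-z` for all `z ≠ 0`. -/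
theorem exists_half_plane : ∃ S : Set ℂ, ∀ z, z ≠ 0 → (-z ∈ S ↔ z ∉ S) := by
  set f : ℂ → ℂ := fun k => k ^ 2 with hf
  refine ⟨{z | Function.invFun f (f z) = z}, fun z hz => ?_⟩
  have h1 : f (Function.invFun f (f z)) = f z := Function.invFun_eq ⟨z, rfl⟩
  have h2 : f (-z) = f z := neg_sq z
  rw [Set.mem_ofPred_eq, Set.mem_ofPred_eq, h2]
  rcases sq_eq_sq_iff_eq_or_eq_neg.mp h1 with h | h
  · rw [h]
    simp only [not_true_eq_false, iff_false]
    exact fun h' => hz (self_eq_neg.mp h')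
  · rw [h]
    simp only [true_iff]
    exact fun h' => hz (neg_eq_self.mp h')

/-- The sign of `χ` relative to the half `S` selects one of the pairs `p 0, p 1` and `p 2, p 3`; the
sign of `ψ` then selects a point of that pair. -/
theorem exists_tiling_of_four (p : Fin 4 → G) (χ ψ : AddChar G Circle)
    (h1 : (χ (p 1) : ℂ) = χ (p 0)) (h2 : (χ (p 2) : ℂ) = -χ (p 0))
    (h3 : (χ (p 3) : ℂ) = -χ (p 0)) (h01 : (ψ (p 0) : ℂ) = -ψ (p 1))
    (h23 : (ψ (p 2) : ℂ) = -ψ (p 3)) : ∃ T : Set G, ∀ z, ∃! k, z - p k ∈ T := by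
  obtain ⟨S, hS⟩ := exists_half_plane
  have hne : ∀ (χ : AddChar G Circle) (z : G), (χ z : ℂ) ≠ 0 := fun χ z => Circle.coe_ne_zero _
  refine ⟨{t | (χ t : ℂ) ∈ S ∧ (ψ t : ℂ) ∈ S}, fun z => ?_⟩
  have a1 : (χ (z - p 1) : ℂ) ∈ S ↔ (χ (z - p 0) : ℂ) ∈ S := by
    rw [AddChar.coe_sub_apply_div, h1, AddChar.coe_sub_apply_div]
  have a2 : (χ (z - p 2) : ℂ) ∈ S ↔ (χ (z - p 0) : ℂ) ∉ S := by
    rw [AddChar.coe_sub_apply_div, h2, div_neg, ← AddChar.coe_sub_apply_div, hS _ (hne _ _)]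
  have a3 : (χ (z - p 3) : ℂ) ∈ S ↔ (χ (z - p 0) : ℂ) ∉ S := by
    rw [AddChar.coe_sub_apply_div, h3, div_neg, ← AddChar.coe_sub_apply_div, hS _ (hne _ _)]
  have b1 : (ψ (z - p 0) : ℂ) ∈ S ↔ (ψ (z - p 1) : ℂ) ∉ S := by
    rw [AddChar.coe_sub_apply_div, h01, div_neg, ← AddChar.coe_sub_apply_div, hS _ (hne _ _)]
  have b2 : (ψ (z - p 2) : ℂ) ∈ S ↔ (ψ (z - p 3) : ℂ) ∉ S := by
    rw [AddChar.coe_sub_apply_div, h23, div_neg, ← AddChar.coe_sub_apply_div, hS _ (hne _ _)]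
  simp only [Set.mem_ofPred_eq]
  by_cases c0 : (χ (z - p 0) : ℂ) ∈ S
  · by_cases c1 : (ψ (z - p 1) : ℂ) ∈ S
    · refine ⟨1, by tauto, fun k hk => ?_⟩
      fin_cases k <;> simp_all
    · refine ⟨0, by tauto, fun k hk => ?_⟩
      fin_cases k <;> simp_all
  · by_cases c1 : (ψ (z - p 3) : ℂ) ∈ S
    · refine ⟨3, by tauto, fun k hk => ?_⟩
      fin_cases k <;> simp_all
    · refine ⟨2, by tauto, fun k hk => ?_⟩
      fin_cases k <;> simp_all

/-! ### Hadamard matrices of order four -/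

/-- The entries of `v` cancel in the pairs `σ 0, σ 1` and `σ 2, σ 3`. -/
def Matched (v : Fin 4 → ℂ) (σ : Equiv.Perm (Fin 4)) : Prop :=
  v (σ 0) = -v (σ 1) ∧ v (σ 2) = -v (σ 3)

/-- The first and third elementary symmetric functions `e₁`, `e₃` vanish, the latter by conjugation,
and `(v 0 + v 1)(v 0 + v 2)(v 0 + v 3) = v 0 ² e₁ + e₃`. -/
theorem matched_of_sum_eq_zero (v : Fin 4 → ℂ) (hv : ∀ k, ‖v k‖ = 1) (h : ∑ k, v k = 0) :
    Matched v 1 ∨ Matched v (Equiv.swap 1 2) ∨ Matched v (Equiv.swap 1 3) := by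
  have hc := fun k => Complex.mul_conj_eq_one (hv k)
  have hinv : ∀ k, conj (v k) = (v k)⁻¹ := fun k => (inv_eq_of_mul_eq_one_right (hc k)).symm
  have hne : ∀ k, v k ≠ 0 := fun k h => by simpa [h] using hc k
  have h3 : ∑ k, (v k)⁻¹ = 0 := by
    simpa only [map_sum, hinv, map_zero] using congrArg conj h
  rw [Fin.sum_univ_four] at h h3
  have e3 : v 1 * v 2 * v 3 + v 0 * v 2 * v 3 + v 0 * v 1 * v 3 + v 0 * v 1 * v 2 = 0 := by
    have : v 1 * v 2 * v 3 + v 0 * v 2 * v 3 + v 0 * v 1 * v 3 + v 0 * v 1 * v 2 =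
        v 0 * v 1 * v 2 * v 3 * ((v 0)⁻¹ + (v 1)⁻¹ + (v 2)⁻¹ + (v 3)⁻¹) := by
      have n0 := hne 0
      have n1 := hne 1
      have n2 := hne 2
      have n3 := hne 3
      field_simp
    rw [this, h3, mul_zero]
  have t0 : Equiv.swap (1 : Fin 4) 2 0 = 0 := by decide
  have t3 : Equiv.swap (1 : Fin 4) 2 3 = 3 := by decide
  have s0 : Equiv.swap (1 : Fin 4) 3 0 = 0 := by decide
  have s2 : Equiv.swap (1 : Fin 4) 3 2 = 2 := by decide
  have hprod : (v 0 + v 1) * ((v 0 + v 2) * (v 0 + v 3)) = 0 := by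
    linear_combination v 0 ^ 2 * h + e3
  simp only [Matched, Equiv.swap_apply_left, Equiv.swap_apply_right, t0, t3, s0, s2,
    Equiv.Perm.one_apply]
  rcases mul_eq_zero.mp hprod with h' | h'
  · exact Or.inl ⟨by linear_combination h', by linear_combination h - h'⟩
  · rcases mul_eq_zero.mp h' with h' | h'
    · exact Or.inr (Or.inl ⟨by linear_combination h', by linear_combination h - h'⟩)
    · exact Or.inr (Or.inr ⟨by linear_combination h', by linear_combination h - h'⟩)

/-- For different pairings the inner product factors as `(v₀ - v₂) conj (u₀ - u₁)`, so one of the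
two vectors also cancels along the third pairing. -/
theorem eq_or_eq_of_matched {v₀ v₁ v₂ v₃ u₀ u₁ u₂ u₃ : ℂ} (hv₁ : v₀ = -v₁) (hv₂ : v₂ = -v₃)
    (hu₁ : u₀ = -u₂) (hu₂ : u₁ = -u₃)
    (h : v₀ * conj u₀ + v₁ * conj u₁ + v₂ * conj u₂ + v₃ * conj u₃ = 0) :
    (v₀ = -v₃ ∧ v₂ = -v₁) ∨ (u₀ = -u₃ ∧ u₂ = -u₁) := by
  obtain rfl : v₁ = -v₀ := by rw [hv₁, neg_neg]
  obtain rfl : v₃ = -v₂ := by rw [hv₂, neg_neg]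
  obtain rfl : u₂ = -u₀ := by rw [hu₁, neg_neg]
  obtain rfl : u₃ = -u₁ := by rw [hu₂, neg_neg]
  simp only [map_neg] at h
  have : (v₀ - v₂) * conj (u₀ - u₁) = 0 := by
    rw [map_sub]
    linear_combination h
  rcases mul_eq_zero.mp this with h' | h'
  · have := sub_eq_zero.mp h'
    left
    simp [this]
  · have := sub_eq_zero.mp ((map_eq_zero _).mp h')
    right
    simp [this]

/-- With a common pairing, `X / Y` is constant on each pair, and orthogonality makes its two values
opposite. So `X / Y` tells the pairs apart and `X` the points within a pair. -/
theorem exists_tiling_of_matched (p : Fin 4 → G) (X Y : AddChar G Circle)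
    (h : ∑ k, (X (p k) : ℂ) * conj (Y (p k) : ℂ) = 0) (σ : Equiv.Perm (Fin 4))
    (hX : Matched (fun k => (X (p k) : ℂ)) σ) (hY : Matched (fun k => (Y (p k) : ℂ)) σ) :
    ∃ T : Set G, ∀ z, ∃! k, z - p k ∈ T := by
  apply exists_tiling_perm p σ
  rw [← Equiv.sum_comp σ, Fin.sum_univ_four] at h
  obtain ⟨hX1, hX2⟩ := hX
  obtain ⟨hY1, hY2⟩ := hY
  simp only [hX1, hX2, hY1, hY2, map_neg] at h
  refine exists_tiling_of_four (fun k => p (σ k)) (X / Y) X ?_ ?_ ?_ hX1 hX2 <;>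
    simp only [AddChar.coe_div_apply, hX1, hX2, hY1, hY2, map_neg]
  · ring
  · linear_combination (1 / 2) * h
  · linear_combination (1 / 2) * h

/-- Two rows that share a pairing suffice. If rows 1 and 2 have different pairings, one of them also
has the third, so row 3 shares a pairing with row 1 or row 2. -/
theorem exists_tiling_of_hadamard_four (p : Fin 4 → G) (χ : Fin 4 → AddChar G Circle)
    (ho : ∀ i j, i ≠ j → ∑ k, (χ i (p k) : ℂ) * conj (χ j (p k) : ℂ) = 0) :
    ∃ T : Set G, ∀ z, ∃! k, z - p k ∈ T := by
  have key : ∀ i j, i ≠ j →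
      ∑ k, ((χ i / χ 0) (p k) : ℂ) * conj ((χ j / χ 0) (p k) : ℂ) = 0 := by
    intro i j hij
    rw [← ho i j hij]
    refine Finset.sum_congr rfl fun k _ => ?_
    simp only [AddChar.coe_div_apply, map_mul, Complex.conj_conj]
    linear_combination (χ i (p k) : ℂ) * conj (χ j (p k) : ℂ) *
      Complex.conj_mul_eq_one (Circle.norm_coe (χ 0 (p k)))
  have hsum : ∀ i, i ≠ 0 → ∑ k, ((χ i / χ 0) (p k) : ℂ) = 0 := by
    intro i hi
    simp only [AddChar.coe_div_apply]
    exact ho i 0 hi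
  have hm := fun i hi => matched_of_sum_eq_zero (fun k => ((χ i / χ 0) (p k) : ℂ))
    (fun k => Circle.norm_coe _) (hsum i hi)
  have share := fun i j hij σ => exists_tiling_of_matched p (χ i / χ 0) (χ j / χ 0) (key i j hij) σ
  have t0 : Equiv.swap (1 : Fin 4) 2 0 = 0 := by decide
  have t3 : Equiv.swap (1 : Fin 4) 2 3 = 3 := by decide
  have s0 : Equiv.swap (1 : Fin 4) 3 0 = 0 := by decide
  have s2 : Equiv.swap (1 : Fin 4) 3 2 = 2 := by decide
  have third : ∀ i j, i ≠ j → ∀ v u : Fin 4 → ℂ, (v = fun k => ((χ i / χ 0) (p k) : ℂ)) →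
      (u = fun k => ((χ j / χ 0) (p k) : ℂ)) →
      (Matched v 1 → Matched u (Equiv.swap 1 2) →
        Matched v (Equiv.swap 1 3) ∨ Matched u (Equiv.swap 1 3)) ∧
      (Matched v 1 → Matched u (Equiv.swap 1 3) →
        Matched v (Equiv.swap 1 2) ∨ Matched u (Equiv.swap 1 2)) ∧
      (Matched v (Equiv.swap 1 2) → Matched u (Equiv.swap 1 3) →
        Matched v 1 ∨ Matched u 1) := by
    intro i j hij v u hv hu
    have h : ∑ k, v k * conj (u k) = 0 := by
      rw [hv, hu]
      exact key i j hij
    rw [Fin.sum_univ_four] at h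
    simp only [Matched, Equiv.swap_apply_left, Equiv.swap_apply_right, t0, t3, s0, s2,
      Equiv.Perm.one_apply]
    refine ⟨?_, ?_, ?_⟩
    · rintro ⟨a1, a2⟩ ⟨b1, b2⟩
      exact eq_or_eq_of_matched a1 a2 b1 b2 h
    · rintro ⟨a1, a2⟩ ⟨b1, b2⟩
      rcases eq_or_eq_of_matched (v₀ := v 0) (v₁ := v 1) (v₂ := v 3) (v₃ := v 2) (u₀ := u 0)
        (u₁ := u 1) (u₂ := u 3) (u₃ := u 2) a1 (by rw [a2, neg_neg]) b1 (by rw [b2, neg_neg])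
        (by linear_combination h) with ⟨c1, c2⟩ | ⟨c1, c2⟩
      · exact Or.inl ⟨c1, by rw [c2, neg_neg]⟩
      · exact Or.inr ⟨c1, by rw [c2, neg_neg]⟩
    · rintro ⟨a1, a2⟩ ⟨b1, b2⟩
      rcases eq_or_eq_of_matched (v₀ := v 0) (v₁ := v 2) (v₂ := v 3) (v₃ := v 1) (u₀ := u 0)
        (u₁ := u 2) (u₂ := u 3) (u₃ := u 1) a1 (by rw [a2, neg_neg]) b1 b2
        (by linear_combination h) with ⟨c1, c2⟩ | ⟨c1, c2⟩
      · exact Or.inl ⟨c1, by rw [c2, neg_neg]⟩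
      · exact Or.inr ⟨c1, by rw [c2, neg_neg]⟩
  have d13 := share 1 3 (by decide)
  have d23 := share 2 3 (by decide)
  obtain ⟨f1, f2, f3⟩ := third 1 2 (by decide) _ _ rfl rfl
  obtain ⟨g1, g2, g3⟩ := third 2 1 (by decide) _ _ rfl rfl
  rcases hm 1 (by decide) with h1 | h1 | h1 <;> rcases hm 2 (by decide) with h2 | h2 | h2 <;>
    first
    | exact share 1 2 (by decide) _ h1 h2
    | rcases hm 3 (by decide) with h3 | h3 | h3 <;>
      first
      | exact share 1 3 (by decide) _ h1 h3
      | exact share 2 3 (by decide) _ h2 h3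
      | exact (f1 h1 h2).elim (fun h => d13 _ h h3) (fun h => d23 _ h h3)
      | exact (f2 h1 h2).elim (fun h => d13 _ h h3) (fun h => d23 _ h h3)
      | exact (f3 h1 h2).elim (fun h => d13 _ h h3) (fun h => d23 _ h h3)
      | exact (g1 h2 h1).elim (fun h => d23 _ h h3) (fun h => d13 _ h h3)
      | exact (g2 h2 h1).elim (fun h => d23 _ h h3) (fun h => d13 _ h h3)
      | exact (g3 h2 h1).elim (fun h => d23 _ h h3) (fun h => d13 _ h h3)

/-- Spectral sets of at most five elements in an abelian group tile the group. -/
theorem exists_tiling_of_hadamard {n : ℕ} (hn : 0 < n) (hn5 : n ≤ 5) (p : Fin n → G)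
    (χ : Fin n → AddChar G Circle)
    (ho : ∀ i j, i ≠ j → ∑ k, (χ i (p k) : ℂ) * conj (χ j (p k) : ℂ) = 0) :
    ∃ T : Set G, ∀ z, ∃! k, z - p k ∈ T := by
  have hsum : ∀ i j, i ≠ j → ∑ k, ((χ i / χ j) (p k) : ℂ) = 0 := by
    intro i j hij
    simp only [AddChar.coe_div_apply]
    exact ho i j hij
  interval_cases n
  · exact exists_tiling_of_pow_eq p hn 1 (Function.injective_of_subsingleton _) fun i j => by
      rw [Subsingleton.elim i j]
  · have h := hsum 0 1 (by decide)
    rw [Fin.sum_univ_two] at h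
    have h' := eq_neg_of_add_eq_zero_left h
    have hne : ((χ 0 / χ 1) (p 1) : ℂ) ≠ 0 := Circle.coe_ne_zero _
    refine exists_tiling_of_pow_eq p hn (χ 0 / χ 1) ?_ ?_
    · intro i j hij
      fin_cases i <;> fin_cases j <;> simp_all [self_eq_neg, neg_eq_self]
    · intro i j
      fin_cases i <;> fin_cases j <;> simp [h']
  · obtain ⟨h1, h2⟩ := injective_and_pow_three _ (fun k => Circle.norm_coe _)
      (hsum 0 1 (by decide))
    exact exists_tiling_of_pow_eq p hn _ h1 h2
  · exact exists_tiling_of_hadamard_four p χ ho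
  · obtain ⟨i, j, hij, h⟩ := exists_sum_sq_eq_zero (fun i k => (χ i (p k) : ℂ))
      (fun i k => Circle.norm_coe _) ho
    simp only [← AddChar.coe_div_apply] at h
    obtain ⟨h1, h2⟩ := injective_and_pow_five _ (fun k => Circle.norm_coe _) (hsum i j hij) h
    exact exists_tiling_of_pow_eq p hn _ h1 h2

end Discrete

/-! ### Unit cubes with integer corners -/

section Cubes

variable {d : ℕ}

/-- The half-open unit cube `[0,1)^d`. -/
def unitCube (d : ℕ) : Set (Fin d → ℝ) := Set.univ.pi fun _ => Set.Ico (0 : ℝ) 1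

/-- The inclusion of `ℤ^d` in `ℝ^d`. -/
def intVec (a : Fin d → ℤ) : Fin d → ℝ := fun i => (a i : ℝ)

/-- The integer part of a vector. -/
noncomputable def floorVec (x : Fin d → ℝ) : Fin d → ℤ := fun i => ⌊x i⌋

theorem intVec_injective : Function.Injective (intVec (d := d)) := fun _ _ h =>
  funext fun i => Int.cast_injective (congrFun h i)

theorem intVec_sub (a b : Fin d → ℤ) : intVec (a - b) = intVec a - intVec b := by
  ext i
  simp [intVec]

theorem sub_intVec_mem_unitCube {x : Fin d → ℝ} {a : Fin d → ℤ} :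
    x - intVec a ∈ unitCube d ↔ floorVec x = a := by
  simp only [unitCube, Set.mem_univ_pi, Pi.sub_apply, intVec, Set.mem_Ico, funext_iff, floorVec,
    Int.floor_eq_iff, sub_nonneg, sub_lt_iff_lt_add']

theorem floorVec_sub_intVec (x : Fin d → ℝ) (a : Fin d → ℤ) :
    floorVec (x - intVec a) = floorVec x - a := by
  ext i
  simp [floorVec, intVec, Int.floor_sub_intCast]

theorem mem_unitCubes {A : Finset (Fin d → ℤ)} {x : Fin d → ℝ} :
    x ∈ unitCubes A ↔ floorVec x ∈ A := by
  constructor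
  · rintro ⟨_, ⟨a, ha, rfl⟩, y, hy, rfl⟩
    have : floorVec (intVec a + y) = a := by
      rw [← sub_intVec_mem_unitCube, add_sub_cancel_left]
      exact hy
    exact (this.symm ▸ ha : floorVec (intVec a + y) ∈ A)
  · intro h
    exact ⟨intVec (floorVec x), ⟨_, h, rfl⟩, x - intVec (floorVec x),
      sub_intVec_mem_unitCube.mpr rfl, add_sub_cancel _ _⟩

theorem measurableSet_unitCube : MeasurableSet (unitCube d) :=
  MeasurableSet.univ_pi fun _ => measurableSet_Ico

theorem measurableSet_cube (a : Fin d → ℤ) :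
    MeasurableSet ((fun x => x - intVec a) ⁻¹' unitCube d) :=
  measurableSet_unitCube.preimage (by fun_prop)

theorem volume_unitCube : volume (unitCube d) = 1 := by
  simp [unitCube, volume_pi_pi]

theorem unitCubes_eq_biUnion (A : Finset (Fin d → ℤ)) :
    unitCubes A = ⋃ a ∈ A, (fun x => x - intVec a) ⁻¹' unitCube d := by
  ext x
  simp [mem_unitCubes, sub_intVec_mem_unitCube]

theorem pairwise_disjoint_cubes :
    Pairwise (Function.onFun Disjoint fun a : Fin d → ℤ => (fun x => x - intVec a) ⁻¹' unitCube d) := by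
  intro a b hab
  refine Set.disjoint_left.mpr fun x hx hx' => hab ?_
  rw [Set.mem_preimage, sub_intVec_mem_unitCube] at hx hx'
  rw [← hx, hx']

/-- Membership of a point in a union of cubes depends only on its integer part, so a tiling of `ℤ^d`
covers every point of `ℝ^d` exactly once. -/
theorem tiles_unitCubes_of_tiling (A : Finset (Fin d → ℤ)) (T : Set (Fin d → ℤ))
    (hT : ∀ z, ∃! a : A, z - (a : Fin d → ℤ) ∈ T) :
    Tiles (volume : Measure (Fin d → ℝ)) (unitCubes A) := by
  refine ⟨intVec '' T, Filter.Eventually.of_forall fun x => ?_⟩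
  obtain ⟨a, ha, huniq⟩ := hT (floorVec x)
  have key : ∀ t : (intVec '' T : Set (Fin d → ℝ)),
      x - t ∈ unitCubes A ↔ t = ⟨intVec (floorVec x - a), _, ha, rfl⟩ := by
    rintro ⟨_, t, ht, rfl⟩
    rw [mem_unitCubes, floorVec_sub_intVec, Subtype.ext_iff]
    change _ ↔ intVec t = intVec (floorVec x - (a : Fin d → ℤ))
    rw [intVec_injective.eq_iff]
    constructor
    · intro h
      rw [← huniq ⟨_, h⟩ (by simpa using ht)]
      simp
    · rintro rfl
      simp
  rw [tsum_eq_single ⟨intVec (floorVec x - a), _, ha, rfl⟩]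
  · exact Set.indicator_of_mem ((key _).mpr rfl) _
  · intro t ht
    exact Set.indicator_of_notMem (fun h => ht ((key t).mp h)) _

theorem lintegral_eq_tsum_cubes (F : (Fin d → ℝ) → ℝ≥0∞) :
    ∫⁻ x, F x = ∑' a : Fin d → ℤ, ∫⁻ x in unitCube d, F (x + intVec a) := by
  have hU : ⋃ a : Fin d → ℤ, (fun x => x - intVec a) ⁻¹' unitCube d = Set.univ := by
    refine Set.eq_univ_of_forall fun x => Set.mem_iUnion.mpr ⟨floorVec x, ?_⟩
    exact sub_intVec_mem_unitCube.mpr rfl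
  rw [← setLIntegral_univ, ← hU, lintegral_iUnion
    measurableSet_cube pairwise_disjoint_cubes]
  refine tsum_congr fun a => ?_
  have := (measurePreserving_sub_right (volume : Measure (Fin d → ℝ)) (intVec a)).setLIntegral_comp_preimage_emb
    (MeasurableEquiv.subRight (intVec a)).measurableEmbedding (fun x => F (x + intVec a)) (unitCube d)
  simpa using this

theorem setIntegral_unitCubes (A : Finset (Fin d → ℤ)) (f : (Fin d → ℝ) → ℂ) (hf : Continuous f)
    (C : ℝ) (hC : ∀ x, ‖f x‖ ≤ C) :
    ∫ x in unitCubes A, f x = ∑ a ∈ A, ∫ x in unitCube d, f (x + intVec a) := by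
  have hpre : ∀ a : Fin d → ℤ, volume ((fun x => x - intVec a) ⁻¹' unitCube d) = 1 := fun a => by
    rw [(measurePreserving_sub_right (volume : Measure (Fin d → ℝ)) (intVec a)).measure_preimage
      measurableSet_unitCube.nullMeasurableSet, volume_unitCube]
  rw [unitCubes_eq_biUnion, integral_biUnion_finset A
    (fun a _ => measurableSet_cube a)
    (fun a _ b _ hab => pairwise_disjoint_cubes hab)]
  · refine Finset.sum_congr rfl fun a _ => ?_
    have := (measurePreserving_sub_right (volume : Measure (Fin d → ℝ)) (intVec a)).setIntegral_preimage_emb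
      (MeasurableEquiv.subRight (intVec a)).measurableEmbedding (fun x => f (x + intVec a)) (unitCube d)
    simpa using this
  · intro a _
    exact Measure.integrableOn_of_bounded (M := C) (by rw [hpre]; exact ENNReal.one_ne_top)
      hf.aestronglyMeasurable (Filter.Eventually.of_forall hC)

theorem volume_unitCubes (A : Finset (Fin d → ℤ)) : volume (unitCubes A) = A.card := by
  rw [unitCubes_eq_biUnion, measure_biUnion_finset (fun a _ b _ hab => pairwise_disjoint_cubes hab)
    (fun a _ => measurableSet_cube a)]
  simp only [fun a : Fin d → ℤ =>
    (measurePreserving_sub_right (volume : Measure (Fin d → ℝ)) (intVec a)).measure_preimage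
      measurableSet_unitCube.nullMeasurableSet, volume_unitCube]
  simp

end Cubes

/-! ### Characters of `ℝ^d` and the Fourier transform of the cube -/

section Characters

/-- A continuous character of the real line is `x ↦ exp (2π i s x)` for some `s`. -/
theorem exists_eq_fourierChar (χ : AddChar ℝ Circle) (hχ : Continuous χ) :
    ∃ s : ℝ, ∀ x, χ x = Real.fourierChar (s * x) := by
  set f : ℝ → ℂ := fun x => χ x with hf
  have hfc : Continuous f := continuous_subtype_val.comp hχ
  have hadd : ∀ x y, f (x + y) = f x * f y := fun x y => by
    simp [hf, AddChar.map_add_eq_mul]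
  have hF : ∀ a x, HasDerivAt (fun u => ∫ t in a..u, f t) (f x) x := fun a x =>
    intervalIntegral.integral_hasDerivAt_right (hfc.intervalIntegrable _ _)
      (hfc.stronglyMeasurableAtFilter _ _) hfc.continuousAt
  -- A nonzero integral `c` over `[0, a]` exists because `f 0 = 1`. Since `c f(x)` is the integral
  -- of `f` over `[x, x + a]`, continuity gives differentiability, and `f` satisfies `f' = k f`.
  obtain ⟨a, ha⟩ : ∃ a, ∫ t in (0 : ℝ)..a, f t ≠ 0 := by
    by_contra! h
    have h1 := hF 0 0
    simp only [h] at h1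
    have h2 := h1.unique (hasDerivAt_const 0 0)
    simp [hf] at h2
  set c := ∫ t in (0 : ℝ)..a, f t with hc
  have hfx : ∀ x, f x = ((∫ t in (0 : ℝ)..(x + a), f t) - ∫ t in (0 : ℝ)..x, f t) / c := by
    intro x
    rw [eq_div_iff ha, intervalIntegral.integral_interval_sub_left (hfc.intervalIntegrable _ _)
      (hfc.intervalIntegrable _ _), hc, ← intervalIntegral.integral_const_mul]
    simp only [← hadd]
    rw [intervalIntegral.integral_comp_add_left (fun t => f t) x, add_zero]
  have hd : ∀ x, HasDerivAt f ((f a - 1) / c * f x) x := by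
    intro x
    have h1 : HasDerivAt (fun u => ∫ t in (0 : ℝ)..(u + a), f t) (f (x + a)) x := by
      simpa using (hF 0 (x + a)).comp_add_const x a
    have h2 := (h1.sub (hF 0 x)).div_const c
    have h4 : (f (x + a) - f x) / c = (f a - 1) / c * f x := by
      rw [hadd]
      ring
    rw [← h4]
    exact h2.congr_of_eventuallyEq (Filter.Eventually.of_forall fun u => hfx u)
  set k := (f a - 1) / c with hk
  have hg : ∀ x : ℝ, f x = Complex.exp (k * x) := by
    have hder : ∀ x : ℝ, HasDerivAt (fun x : ℝ => f x * Complex.exp (-(k * x))) 0 x := by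
      intro x
      have h1 : HasDerivAt (fun x : ℝ => -(k * (x : ℂ))) (-(k * 1)) x :=
        ((Complex.ofRealCLM.hasDerivAt (x := x)).const_mul k).neg
      have h2 := (hd x).mul h1.cexp
      refine h2.congr_deriv ?_
      ring
    intro x
    have h1 := is_const_of_deriv_eq_zero (fun x => (hder x).differentiableAt)
      (fun x => (hder x).deriv) x 0
    have f0 : f 0 = 1 := by simp [hf]
    simp only [f0, Complex.ofReal_zero, mul_zero, neg_zero, Complex.exp_zero, mul_one] at h1
    rw [Complex.exp_neg, ← div_eq_mul_inv, div_eq_one_iff_eq (Complex.exp_ne_zero _)] at h1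
    exact h1
  have hre : k.re = 0 := by
    have h1 : ‖f 1‖ = 1 := Circle.norm_coe _
    rw [hg, Complex.norm_exp] at h1
    simpa using h1
  refine ⟨k.im / (2 * Real.pi), fun x => Circle.ext ?_⟩
  rw [Real.fourierChar_apply]
  refine (hg x).trans ?_
  congr 1
  have : k = k.im * Complex.I := by
    apply Complex.ext <;> simp [hre]
  rw [this]
  have hpi : (Real.pi : ℂ) ≠ 0 := by exact_mod_cast Real.pi_ne_zero
  push_cast
  simp only [Complex.mul_im, Complex.ofReal_re, Complex.I_im, mul_one, Complex.ofReal_im,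
    Complex.I_re, mul_zero, add_zero]
  field_simp

variable {d : ℕ}

/-- The exponential `x ↦ exp (2π i ⟨ξ, x⟩)`. -/
noncomputable def wave (ξ x : Fin d → ℝ) : ℂ := Real.fourierChar (ξ ⬝ᵥ x)

theorem exists_eq_wave (χ : AddChar (Fin d → ℝ) Circle) (hχ : Continuous χ) :
    ∃ ξ : Fin d → ℝ, ∀ x, (χ x : ℂ) = wave ξ x := by
  have h : ∀ i, ∃ s : ℝ, ∀ t, χ (Pi.single i t) = Real.fourierChar (s * t) := fun i =>
    exists_eq_fourierChar (χ.compAddMonoidHom (AddMonoidHom.single (fun _ => ℝ) i))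
      (hχ.comp (continuous_single (A := fun _ => ℝ) i))
  choose ξ hξ using h
  refine ⟨ξ, fun x => ?_⟩
  rw [wave]
  congr 1
  have hsum : ∀ (ψ : AddChar (Fin d → ℝ) Circle) (s : Finset (Fin d)) (v : Fin d → Fin d → ℝ),
      ψ (∑ i ∈ s, v i) = ∏ i ∈ s, ψ (v i) := fun ψ s v =>
    map_prod ψ.toMonoidHom (fun i => Multiplicative.ofAdd (v i)) s
  have hsum' : ∀ (s : Finset (Fin d)) (v : Fin d → ℝ),
      Real.fourierChar (∑ i ∈ s, v i) = ∏ i ∈ s, Real.fourierChar (v i) := fun s v =>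
    map_prod Real.fourierChar.toMonoidHom (fun i => Multiplicative.ofAdd (v i)) s
  rw [dotProduct, hsum']
  conv_lhs => rw [← Finset.univ_sum_single x, hsum]
  exact Finset.prod_congr rfl fun i _ => hξ i (x i)

theorem wave_comm (ξ x : Fin d → ℝ) : wave ξ x = wave x ξ := by
  rw [wave, wave, dotProduct_comm]

theorem wave_add_right (ξ x y : Fin d → ℝ) : wave ξ (x + y) = wave ξ x * wave ξ y := by
  simp [wave, dotProduct_add, AddChar.map_add_eq_mul]

theorem wave_add_left (ξ η x : Fin d → ℝ) : wave (ξ + η) x = wave ξ x * wave η x := by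
  simp [wave, add_dotProduct, AddChar.map_add_eq_mul]

theorem wave_neg_left (ξ x : Fin d → ℝ) : wave (-ξ) x = conj (wave ξ x) := by
  rw [wave, neg_dotProduct, AddChar.map_neg_eq_inv, Circle.coe_inv_eq_conj, wave]

theorem conj_wave_mul_wave (ξ η x : Fin d → ℝ) : conj (wave ξ x) * wave η x = wave (η - ξ) x := by
  rw [sub_eq_add_neg, wave_add_left, wave_neg_left, mul_comm]

@[simp] theorem wave_zero_left (x : Fin d → ℝ) : wave 0 x = 1 := by
  simp [wave]

@[simp] theorem norm_wave (ξ x : Fin d → ℝ) : ‖wave ξ x‖ = 1 := Circle.norm_coe _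

theorem continuous_uncurry_wave : Continuous fun p : (Fin d → ℝ) × (Fin d → ℝ) => wave p.1 p.2 := by
  unfold wave dotProduct
  exact continuous_subtype_val.comp (Real.continuous_fourierChar.comp (by fun_prop))

theorem continuous_wave (ξ : Fin d → ℝ) : Continuous (wave ξ) :=
  continuous_uncurry_wave.comp (by fun_prop : Continuous fun x => (ξ, x))

theorem wave_intVec_intVec (a b : Fin d → ℤ) : wave (intVec a) (intVec b) = 1 := by
  have : intVec a ⬝ᵥ intVec b = ((a ⬝ᵥ b : ℤ) : ℝ) := by
    simp [dotProduct, intVec]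
  rw [wave, this, Real.fourierChar_apply, Complex.exp_eq_one_iff]
  refine ⟨a ⬝ᵥ b, ?_⟩
  push_cast
  ring

theorem setIntegral_fourierChar (s : ℝ) :
    (∫ t in Set.Ico (0 : ℝ) 1, (Real.fourierChar (s * t) : ℂ)) =
      if s = 0 then 1 else (Complex.exp (2 * Real.pi * Complex.I * s) - 1) /
        (2 * Real.pi * Complex.I * s) := by
  split_ifs with hs
  · simp [hs]
  · have hne : 2 * (Real.pi : ℂ) * Complex.I * s ≠ 0 := by
      simp [hs, Real.pi_ne_zero]
    rw [integral_Ico_eq_integral_Ioo, ← integral_Ioc_eq_integral_Ioo,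
      ← intervalIntegral.integral_of_le zero_le_one]
    have h := integral_exp_mul_complex (a := 0) (b := 1) hne
    simp only [Complex.ofReal_one, mul_one, Complex.ofReal_zero, mul_zero, Complex.exp_zero] at h
    rw [← h]
    refine intervalIntegral.integral_congr fun t _ => ?_
    simp only [Real.fourierChar_apply]
    congr 1
    push_cast
    ring

theorem setIntegral_fourierChar_intCast (k : ℤ) (hk : k ≠ 0) :
    (∫ t in Set.Ico (0 : ℝ) 1, (Real.fourierChar (k * t) : ℂ)) = 0 := by
  rw [setIntegral_fourierChar, if_neg (by exact_mod_cast hk), div_eq_zero_iff, sub_eq_zero]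
  left
  rw [Complex.exp_eq_one_iff]
  exact ⟨k, by push_cast; ring⟩

/-- The zeros of the transform of `[0,1)` are exactly the nonzero integers. -/
theorem setIntegral_fourierChar_ne_zero (s : ℝ) (hs : |s| < 1) :
    (∫ t in Set.Ico (0 : ℝ) 1, (Real.fourierChar (s * t) : ℂ)) ≠ 0 := by
  rw [setIntegral_fourierChar]
  split_ifs with h
  · exact one_ne_zero
  · have hne : 2 * (Real.pi : ℂ) * Complex.I ≠ 0 := by simp [Real.pi_ne_zero]
    refine div_ne_zero (fun h0 => ?_) (mul_ne_zero hne (by exact_mod_cast h))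
    obtain ⟨m, hm⟩ := Complex.exp_eq_one_iff.mp (sub_eq_zero.mp h0)
    rw [mul_comm (m : ℂ)] at hm
    have hsm : s = m := by exact_mod_cast mul_left_cancel₀ hne hm
    rw [hsm] at hs
    have : m = 0 := Int.abs_lt_one_iff.mp (by exact_mod_cast hs)
    exact h (by rw [hsm, this]; simp)

theorem setIntegral_unitCube_wave (ξ : Fin d → ℝ) :
    ∫ x in unitCube d, wave ξ x =
      ∏ i, ∫ t in Set.Ico (0 : ℝ) 1, (Real.fourierChar (ξ i * t) : ℂ) := by
  rw [unitCube, volume_pi, Measure.restrict_pi_pi, ← integral_fintype_prod_eq_prod]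
  refine integral_congr_ae (Filter.Eventually.of_forall fun x => ?_)
  have hsum' : ∀ (s : Finset (Fin d)) (v : Fin d → ℝ),
      Real.fourierChar (∑ i ∈ s, v i) = ∏ i ∈ s, Real.fourierChar (v i) := fun s v =>
    map_prod Real.fourierChar.toMonoidHom (fun i => Multiplicative.ofAdd (v i)) s
  simp only [wave, dotProduct, hsum']
  exact map_prod Circle.coeHom _ _

theorem setIntegral_unitCube_wave_intVec (k : Fin d → ℤ) :
    ∫ x in unitCube d, wave (intVec k) x = if k = 0 then 1 else 0 := by
  rw [setIntegral_unitCube_wave]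
  split_ifs with hk
  · simp [hk, intVec]
  · obtain ⟨i, hi⟩ := Function.ne_iff.mp hk
    exact Finset.prod_eq_zero (Finset.mem_univ i) (setIntegral_fourierChar_intCast _ hi)

theorem setIntegral_unitCube_wave_ne_zero (ξ : Fin d → ℝ) (hξ : ∀ i, |ξ i| < 1) :
    ∫ x in unitCube d, wave ξ x ≠ 0 := by
  rw [setIntegral_unitCube_wave]
  exact Finset.prod_ne_zero_iff.mpr fun i _ => setIntegral_fourierChar_ne_zero _ (hξ i)

end Characters

/-! ### Parseval's identity and the density of a spectrum -/

section Parseval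

variable {d : ℕ}

/-- The exponential with frequency `ξ` as an element of `L²`. -/
noncomputable def waveLp (μ : Measure (Fin d → ℝ)) [IsFiniteMeasure μ] (ξ : Fin d → ℝ) : Lp ℂ 2 μ :=
  (MemLp.of_bound (p := 2) (μ := μ) (continuous_wave ξ).aestronglyMeasurable 1
    (Filter.Eventually.of_forall fun x => (norm_wave ξ x).le)).toLp

theorem coeFn_waveLp (μ : Measure (Fin d → ℝ)) [IsFiniteMeasure μ] (ξ : Fin d → ℝ) :
    waveLp μ ξ =ᵐ[μ] wave ξ := MemLp.coeFn_toLp _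

theorem inner_waveLp (μ : Measure (Fin d → ℝ)) [IsFiniteMeasure μ] (ξ η : Fin d → ℝ) :
    inner ℂ (waveLp μ ξ) (waveLp μ η) = ∫ x, wave (η - ξ) x ∂μ := by
  rw [L2.inner_def]
  refine integral_congr_ae ?_
  filter_upwards [coeFn_waveLp μ ξ, coeFn_waveLp μ η] with x h1 h2
  rw [h1, h2, RCLike.inner_apply, mul_comm]
  exact conj_wave_mul_wave ξ η x

instance isFiniteMeasure_restrict_unitCube :
    IsFiniteMeasure ((volume : Measure (Fin d → ℝ)).restrict (unitCube d)) :=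
  isFiniteMeasure_restrict.mpr (by rw [volume_unitCube]; exact ENNReal.one_ne_top)

instance isFiniteMeasure_restrict_unitCubes (A : Finset (Fin d → ℤ)) :
    IsFiniteMeasure ((volume : Measure (Fin d → ℝ)).restrict (unitCubes A)) :=
  isFiniteMeasure_restrict.mpr (by rw [volume_unitCubes]; exact ENNReal.natCast_ne_top _)

/-- The Fourier transform of the set `A`. -/
noncomputable def charSum (A : Finset (Fin d → ℤ)) (ξ : Fin d → ℝ) : ℂ :=
  ∑ a ∈ A, wave ξ (intVec a)

theorem setIntegral_unitCubes_wave (A : Finset (Fin d → ℤ)) (ξ : Fin d → ℝ) :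
    ∫ x in unitCubes A, wave ξ x = charSum A ξ * ∫ x in unitCube d, wave ξ x := by
  rw [setIntegral_unitCubes A _ (continuous_wave ξ) 1 fun x => (norm_wave ξ x).le, charSum,
    Finset.sum_mul]
  refine Finset.sum_congr rfl fun a _ => ?_
  rw [← integral_const_mul]
  simp only [wave_add_right, mul_comm]

theorem charSum_add_intVec (A : Finset (Fin d → ℤ)) (ξ : Fin d → ℝ) (k : Fin d → ℤ) :
    charSum A (ξ + intVec k) = charSum A ξ := by
  simp [charSum, wave_add_left, wave_intVec_intVec]

theorem orthonormal_waveLp_intVec :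
    Orthonormal ℂ fun k : Fin d → ℤ => waveLp (volume.restrict (unitCube d)) (-intVec k) := by
  rw [orthonormal_iff_ite]
  intro k l
  rw [inner_waveLp, show -intVec l - -intVec k = intVec (k - l) by rw [intVec_sub]; abel,
    setIntegral_unitCube_wave_intVec]
  simp only [sub_eq_zero]

/-- This is Bessel's inequality for the integer exponentials; their completeness is not needed. -/
theorem tsum_norm_sq_setIntegral_unitCube_le (ξ : Fin d → ℝ) :
    ∑' k : Fin d → ℤ, ENNReal.ofReal (‖∫ x in unitCube d, wave (ξ + intVec k) x‖ ^ 2) ≤ 1 := by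
  refine Summable.tsum_le_of_sum_le ENNReal.summable fun s => ?_
  rw [← ENNReal.ofReal_sum_of_nonneg fun _ _ => sq_nonneg _, ← ENNReal.ofReal_one]
  refine ENNReal.ofReal_le_ofReal ?_
  have h := orthonormal_waveLp_intVec.sum_inner_products_le
    (waveLp (volume.restrict (unitCube d)) ξ) (s := s)
  have h1 : ‖waveLp (volume.restrict (unitCube d)) ξ‖ ^ 2 = 1 := by
    rw [← inner_self_eq_norm_sq (𝕜 := ℂ), inner_waveLp, sub_self]
    simp [measureReal_def, volume_unitCube]
  simpa only [inner_waveLp, sub_neg_eq_add, h1] using h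

theorem lintegral_charSum_sq (A : Finset (Fin d → ℤ)) :
    ∫⁻ ξ in unitCube d, ENNReal.ofReal (‖charSum A ξ‖ ^ 2) = A.card := by
  have hint : ∀ ξ : Fin d → ℝ, Integrable (wave ξ) (volume.restrict (unitCube d)) := fun ξ =>
    Measure.integrableOn_of_bounded (M := 1) (by rw [volume_unitCube]; exact ENNReal.one_ne_top)
      (continuous_wave ξ).aestronglyMeasurable
      (Filter.Eventually.of_forall fun x => (norm_wave ξ x).le)
  have hexp : ∀ ξ, ((‖charSum A ξ‖ ^ 2 : ℝ) : ℂ) =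
      ∑ a ∈ A, ∑ b ∈ A, wave (intVec (b - a)) ξ := by
    intro ξ
    rw [← Complex.normSq_eq_norm_sq, ← Complex.mul_conj, mul_comm, charSum, map_sum,
      Finset.sum_mul_sum]
    refine Finset.sum_congr rfl fun a _ => Finset.sum_congr rfl fun b _ => ?_
    rw [wave_comm ξ, wave_comm ξ, conj_wave_mul_wave, intVec_sub]
  have hint' : Integrable (fun ξ => ∑ a ∈ A, ∑ b ∈ A, wave (intVec (b - a)) ξ)
      (volume.restrict (unitCube d)) :=
    integrable_finsetSum _ fun a _ => integrable_finsetSum _ fun b _ => hint _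
  have hintR : Integrable (fun ξ => ‖charSum A ξ‖ ^ 2) (volume.restrict (unitCube d)) := by
    have := hint'.re
    simp only [← hexp] at this
    exact this
  rw [← ofReal_integral_eq_lintegral_ofReal hintR
    (Filter.Eventually.of_forall fun _ => sq_nonneg _)]
  have hval : ((∫ ξ in unitCube d, ‖charSum A ξ‖ ^ 2 : ℝ) : ℂ) = A.card := by
    rw [← integral_complex_ofReal]
    simp only [hexp]
    rw [integral_finsetSum _ fun a _ => integrable_finsetSum _ fun b _ => hint _]
    simp only [fun a => integral_finsetSum A fun b _ => hint (intVec (b - a)),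
      setIntegral_unitCube_wave_intVec, sub_eq_zero]
    simp
  have hval' : ∫ ξ in unitCube d, ‖charSum A ξ‖ ^ 2 = (A.card : ℝ) := by exact_mod_cast hval
  rw [hval', ENNReal.ofReal_natCast]

/-- The power spectrum of the union of cubes `A + [0,1)^d`. -/
noncomputable def powerSpectrum (A : Finset (Fin d → ℤ)) (ξ : Fin d → ℝ) : ℝ≥0∞ :=
  ENNReal.ofReal (‖∫ x in unitCubes A, wave ξ x‖ ^ 2)

theorem measurable_powerSpectrum (A : Finset (Fin d → ℤ)) : Measurable (powerSpectrum A) := by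
  have : StronglyMeasurable fun ξ : Fin d → ℝ => ∫ x in unitCubes A, wave ξ x :=
    StronglyMeasurable.integral_prod_right (f := wave)
      continuous_uncurry_wave.stronglyMeasurable
  exact (this.measurable.norm.pow_const 2).ennreal_ofReal

/-- The factor `charSum A` is periodic under `ℤ^d`. Folding the integral into one cube leaves the
integral of its squared modulus times a sum bounded by 1. -/
theorem lintegral_powerSpectrum_le (A : Finset (Fin d → ℤ)) :
    ∫⁻ ξ, powerSpectrum A ξ ≤ A.card := by
  have hm : ∀ k : Fin d → ℤ, AEMeasurable (fun ξ => powerSpectrum A (ξ + intVec k))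
      (volume.restrict (unitCube d)) := fun k =>
    ((measurable_powerSpectrum A).comp (measurable_id.add_const _)).aemeasurable
  rw [lintegral_eq_tsum_cubes, ← lintegral_tsum hm, ← lintegral_charSum_sq]
  refine lintegral_mono fun ξ => ?_
  simp only [powerSpectrum, setIntegral_unitCubes_wave, charSum_add_intVec,
    norm_mul, mul_pow, ENNReal.ofReal_mul (sq_nonneg _), ENNReal.tsum_mul_left]
  exact mul_le_of_le_one_right' (tsum_norm_sq_setIntegral_unitCube_le ξ)

theorem eq_waveLp_of_ae_eq {A : Finset (Fin d → ℤ)} {ξ : Fin d → ℝ}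
    {f : Lp ℂ 2 (volume.restrict (unitCubes A))}
    (hf : f =ᵐ[volume.restrict (unitCubes A)] wave ξ) : f = waveLp _ ξ :=
  Lp.ext (hf.trans (coeFn_waveLp _ ξ).symm)

/-- Parseval's identity for a spectrum, applied to an exponential. -/
theorem tsum_powerSpectrum {A : Finset (Fin d → ℤ)} (hA : A.Nonempty) {ι : Type*}
    (f : ι → Fin d → ℝ)
    (horth : ∀ i j, i ≠ j → ∫ x in unitCubes A, wave (f i - f j) x = 0)
    (hspan : (Submodule.span ℂ (Set.range fun i =>
      waveLp (volume.restrict (unitCubes A)) (f i))).topologicalClosure = ⊤) (ξ : Fin d → ℝ) :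
    ∑' i, powerSpectrum A (ξ - f i) = (A.card : ℝ≥0∞) ^ 2 := by
  set w := waveLp (volume.restrict (unitCubes A)) with hw
  set n : ℝ := (A.card : ℝ) with hn
  have n0 : 0 < n := by simpa [hn] using hA.card_pos
  have hself : ∀ η, inner ℂ (w η) (w η) = (n : ℂ) := by
    intro η
    rw [hw, inner_waveLp, sub_self]
    simp [measureReal_def, volume_unitCubes, hn]
  -- The exponentials have norm `√n` in `L²(Ω)`. This normalisation gives one factor `n` of the
  -- result, and `‖w ξ‖² = n` gives the other.
  set r : ℂ := ((Real.sqrt n : ℝ) : ℂ) with hr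
  have r0 : r ≠ 0 := by
    rw [hr]
    exact_mod_cast (Real.sqrt_pos.mpr n0).ne'
  have rr : r * r = n := by
    rw [hr, ← Complex.ofReal_mul, Real.mul_self_sqrt n0.le]
  have rc : conj r = r := Complex.conj_ofReal _
  have hon : Orthonormal ℂ fun i => r⁻¹ • w (f i) := by
    classical
    rw [orthonormal_iff_ite]
    intro i j
    rw [inner_smul_left, inner_smul_right, map_inv₀, rc]
    split_ifs with hij
    · subst hij
      rw [hself, ← rr]
      field_simp
    · rw [hw, inner_waveLp, horth j i (Ne.symm hij), mul_zero, mul_zero]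
  have hsp : ⊤ ≤ (Submodule.span ℂ (Set.range fun i => r⁻¹ • w (f i))).topologicalClosure := by
    rw [← hspan]
    refine Submodule.topologicalClosure_mono (Submodule.span_le.mpr ?_)
    rintro _ ⟨i, rfl⟩
    have : w (f i) = r • (r⁻¹ • w (f i)) := by rw [smul_smul, mul_inv_cancel₀ r0, one_smul]
    change w (f i) ∈ Submodule.span ℂ _
    rw [this]
    exact Submodule.smul_mem _ _ (Submodule.subset_span ⟨i, rfl⟩)
  set b := HilbertBasis.mk hon hsp with hb
  have hsum := b.hasSum_inner_mul_inner (w ξ) (w ξ)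
  have hterm : ∀ i, inner ℂ (w ξ) (b i) * inner ℂ (b i) (w ξ) =
      ((‖∫ x in unitCubes A, wave (ξ - f i) x‖ ^ 2 / n : ℝ) : ℂ) := by
    intro i
    rw [← inner_conj_symm, ← Complex.normSq_eq_conj_mul_self, Complex.normSq_eq_norm_sq, hb,
      HilbertBasis.coe_mk, inner_smul_left, hw, inner_waveLp, norm_mul, mul_pow, map_inv₀, rc,
      norm_inv, inv_pow, hr, Complex.norm_real, Real.norm_eq_abs, sq_abs, Real.sq_sqrt n0.le]
    congr 1
    ring
  rw [hself] at hsum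
  simp only [hterm] at hsum
  have hsum' : HasSum (fun i => ‖∫ x in unitCubes A, wave (ξ - f i) x‖ ^ 2 / n) n :=
    Complex.hasSum_ofReal.mp hsum
  have hsum'' := hsum'.mul_right n
  simp only [div_mul_cancel₀ _ n0.ne'] at hsum''
  simp only [powerSpectrum]
  rw [← ENNReal.ofReal_tsum_of_nonneg (fun i => sq_nonneg _) hsum''.summable, hsum''.tsum_eq,
    ENNReal.ofReal_mul n0.le, hn, ENNReal.ofReal_natCast, pow_two]

/-- If the translates of a function with integral at most `n` along `f` add up to `n²`, then some
unit cube contains at least `n` of the points `f i`. -/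
theorem exists_fin_embedding_mem_unitCube {ι : Type*} (f : ι → Fin d → ℝ) {n : ℕ} (hn : 0 < n)
    {F : (Fin d → ℝ) → ℝ≥0∞} (hF : Measurable F) (hint : ∫⁻ ξ, F ξ ≤ n)
    (hsum : ∀ ξ, ∑' i, F (ξ - f i) = (n : ℝ≥0∞) ^ 2) :
    ∃ (y : Fin d → ℝ) (s : Fin n ↪ ι), ∀ k, y + f (s k) ∈ unitCube d := by
  classical
  by_contra! hcon
  have hfin : ∀ (y : Fin d → ℝ) (t : Finset ι), (∀ i ∈ t, y + f i ∈ unitCube d) →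
      t.card ≤ n - 1 := by
    intro y t ht
    by_contra! hlt
    obtain ⟨u, hu, hcard⟩ := Finset.exists_subset_card_eq (show n ≤ t.card by omega)
    let e : Fin n ≃ u := (u.equivFinOfCardEq hcard).symm
    obtain ⟨k, hk⟩ := hcon y (e.toEmbedding.trans (Function.Embedding.subtype _))
    exact hk (ht _ (hu (e k).2))
  -- Countability is what permits exchanging the sum over `ι` with the integral.
  have hcount : Countable ι := by
    rw [← Set.countable_univ_iff]
    have hU : (Set.univ : Set ι) ⊆ ⋃ a : Fin d → ℤ, {i | floorVec (f i) = a} := fun i _ =>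
      Set.mem_iUnion.mpr ⟨_, rfl⟩
    refine (Set.countable_iUnion fun a => ?_).mono hU
    refine Set.Finite.countable (Set.not_infinite.mp fun hinf => ?_)
    obtain ⟨t, ht, hcard⟩ := hinf.exists_subset_card_eq n
    have := hfin (-intVec a) t fun i hi => by
      rw [neg_add_eq_sub, sub_intVec_mem_unitCube]
      exact ht hi
    omega
  have hle : ∀ y, ∑' i, (unitCube d).indicator (1 : (Fin d → ℝ) → ℝ≥0∞) (y + f i) ≤
      ((n - 1 : ℕ) : ℝ≥0∞) := by
    intro y
    refine Summable.tsum_le_of_sum_le ENNReal.summable fun t => ?_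
    simp only [Set.indicator_apply, Pi.one_apply, Finset.sum_boole]
    exact_mod_cast hfin y _ fun i hi => (Finset.mem_filter.mp hi).2
  have hmeas : Measurable ((unitCube d).indicator (1 : (Fin d → ℝ) → ℝ≥0∞)) :=
    measurable_one.indicator measurableSet_unitCube
  -- Integrating the constant sum `n²` over a cube and shifting each term by `f i` turns the sum
  -- into `F` weighted by the number of points in a translated cube, by assumption at most `n - 1`.
  have key : (n : ℝ≥0∞) ^ 2 ≤ ((n - 1 : ℕ) : ℝ≥0∞) * n := by
    calc (n : ℝ≥0∞) ^ 2 = ∫⁻ ξ in unitCube d, ∑' i, F (ξ - f i) := by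
          simp [hsum, volume_unitCube]
      _ = ∑' i, ∫⁻ ξ in unitCube d, F (ξ - f i) :=
          lintegral_tsum fun i => (hF.comp (measurable_id.sub_const _)).aemeasurable
      _ = ∑' i, ∫⁻ y, (unitCube d).indicator (1 : (Fin d → ℝ) → ℝ≥0∞) (y + f i) * F y := by
          refine tsum_congr fun i => ?_
          rw [← lintegral_indicator measurableSet_unitCube, ← lintegral_add_right_eq_self _ (f i)]
          refine lintegral_congr fun y => ?_
          simp [Set.indicator_apply]
      _ = ∫⁻ y, ∑' i, (unitCube d).indicator (1 : (Fin d → ℝ) → ℝ≥0∞) (y + f i) * F y :=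
          (lintegral_tsum fun i =>
            ((hmeas.comp (measurable_id.add_const _)).mul hF).aemeasurable).symm
      _ ≤ ∫⁻ y, ((n - 1 : ℕ) : ℝ≥0∞) * F y := by
          refine lintegral_mono fun y => ?_
          rw [ENNReal.tsum_mul_right]
          exact mul_le_mul_left (hle y) _
      _ ≤ ((n - 1 : ℕ) : ℝ≥0∞) * n := by
          rw [lintegral_const_mul _ hF]
          exact mul_le_mul_right hint _
  have key' : n ^ 2 ≤ (n - 1) * n := by exact_mod_cast key
  rw [pow_two] at key'
  have := Nat.le_of_mul_le_mul_right key' hn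
  omega

/-- A spectral union of `n` unit cubes has `n` frequencies that are pairwise orthogonal on the set
of the corner points of the cubes. -/
theorem exists_orthogonal_frequencies {A : Finset (Fin d → ℤ)} (hA : A.Nonempty)
    (h : IsSpectral (volume : Measure (Fin d → ℝ)) (unitCubes A)) :
    ∃ g : Fin A.card → Fin d → ℝ, ∀ i j, i ≠ j → charSum A (g i - g j) = 0 := by
  obtain ⟨Λ, hcont, v, hv, -, horth, hspan⟩ := h
  choose f hf using fun χ : Λ => exists_eq_wave χ.1 (hcont χ χ.2)
  have hvw : ∀ χ, v χ = waveLp _ (f χ) := fun χ =>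
    eq_waveLp_of_ae_eq ((hv χ).trans (Filter.Eventually.of_forall (hf χ)))
  have horth' : ∀ i j, i ≠ j → ∫ x in unitCubes A, wave (f i - f j) x = 0 := by
    intro i j hij
    rw [← inner_waveLp, ← hvw, ← hvw]
    exact horth j i hij.symm
  rw [show v = fun i => waveLp (volume.restrict (unitCubes A)) (f i) from funext hvw] at hspan
  obtain ⟨y, s, hs⟩ := exists_fin_embedding_mem_unitCube f hA.card_pos
    (measurable_powerSpectrum A) (lintegral_powerSpectrum_le A) (tsum_powerSpectrum hA f horth' hspan)
  refine ⟨fun k => f (s k), fun i j hij => ?_⟩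
  have h0 := horth' (s i) (s j) (s.injective.ne hij)
  rw [setIntegral_unitCubes_wave] at h0
  -- Coordinates of two points of one half-open unit cube differ by less than 1, so the transform of
  -- the cube is nonzero at their difference.
  refine (mul_eq_zero.mp h0).resolve_right (setIntegral_unitCube_wave_ne_zero _ fun l => ?_)
  have h1 := hs i l (Set.mem_univ l)
  have h2 := hs j l (Set.mem_univ l)
  simp only [Pi.add_apply, Set.mem_Ico] at h1 h2
  rw [Pi.sub_apply, abs_lt]
  constructor <;> linarith [h1.1, h1.2, h2.1, h2.2]

/-- The restriction of the exponential with frequency `ξ` to `ℤ^d`. -/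
noncomputable def latticeChar (ξ : Fin d → ℝ) : AddChar (Fin d → ℤ) Circle where
  toFun z := Real.fourierChar (ξ ⬝ᵥ intVec z)
  map_zero_eq_one' := by simp [intVec, dotProduct]
  map_add_eq_mul' a b := by
    rw [show intVec (a + b) = intVec a + intVec b by ext i; simp [intVec], dotProduct_add,
      AddChar.map_add_eq_mul]

end Parseval

theorem theorem2p4 (d : ℕ) (A : Finset (Fin d → ℤ)) (hA : A.Nonempty) (hcard : A.card ≤ 5)
    (hspec : IsSpectral (volume : Measure (Fin d → ℝ)) (unitCubes A)) :
    Tiles (volume : Measure (Fin d → ℝ)) (unitCubes A) := by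
  obtain ⟨g, hg⟩ := exists_orthogonal_frequencies hA hspec
  let e : Fin A.card ≃ A := A.equivFin.symm
  obtain ⟨T, hT⟩ := exists_tiling_of_hadamard hA.card_pos hcard
    (fun k => ((e k : A) : Fin d → ℤ)) (fun i => latticeChar (g i)) (fun i j hij => by
      rw [← hg i j hij, charSum, ← Finset.sum_coe_sort A, ← e.sum_comp]
      refine Finset.sum_congr rfl fun k _ => ?_
      rw [mul_comm]
      exact conj_wave_mul_wave (g j) (g i) _)
  exact tiles_unitCubes_of_tiling A T fun z => (e.existsUnique_congr fun {k} => Iff.rfl).mp (hT z)
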